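/- **Setting.** Let $\ell,\nu,\chi,\delta>0$, $N\in\{0,1,2,\dots\}$, $\Omega=(0,\ell)^3$, and let $(\cdot,\cdot)$, $\|\cdot\|$ be the inner product and norm of $L^2(\Omega)$. Let $f=f(x)$ and $u_0=u_0(x)$ be smooth vector fields on $\mathbb R^3$ that are $\ell$-periodic in each coordinate, divergence free and of mean zero over $\Omega$, with $f\not\equiv0$. For $\phi\in L^2(\Omega)^3$ let $\overline\phi=G\phi=(I-\delta^2\Delta)^{-1}\phi$ be the periodic solution of $-\delta^2\Delta\overline\phi+\overline\phi=\phi$, and let $G_N$ be the $N$-th van Cittert deconvolution operator: $G_N\overline\phi=\phi_N$, where $\phi_0=\overline\phi$ and $\phi_{n+1}=\phi_n+(\overline\phi-G\phi_n)$. Let $B$ be the positive square root of $\delta^{-(2N+2)}(I-G_NG)$ on $L^2(\Omega)^3$. Let $u$ be an $\ell$-periodic, mean-zero solution on $[0,\infty)$ of the time relaxation model $$u_t+u\cdot\nabla u-\nu\Delta u+\nabla p+\chi(u-G_N\overline u)=f,\qquad \nabla\cdot u=0,\qquad u(\cdot,0)=u_0 ,$$ where a solution is either a Leray–Hopf weak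 solution, i.e. $u\in L^\infty(0,T;L^2)\cap L^2(0,T;H^1_{\mathrm{per}})$ for all $T>0$, $u$ satisfies the weak form of the problem against smooth periodic divergence-free mean-zero test fields, and for a.e. $t>0$ the energy inequality $$\tfrac12\|u(t)\|^2+\int_0^t\big(\nu\|\nabla u\|^2+\chi(u-G_N\overline u,u)\big)\,ds\le\tfrac12\|u_0\|^2+\int_0^t(f,u)\,ds;$$ or a classical solution, i.e. there is a pressure $p$, $\ell$-periodic and $C^1$ in $x$, such that the equations hold for $t>0$, $u$ is continuous on $[0,\infty)\times\mathbb R^3$, and $u$ is $C^1$ in $t$ and $C^2$ in $x$, with these derivatives jointly continuous, for $t>0$ (no energy relation is assumed in this case). For a function $\psi$ of time put $\langle\psi\rangle=\limsup_{T\to\infty}\frac1T\int_0^T\psi(t)\,dt$. Let $$\varepsilon(u)(t)=\frac1{|\Omega|}\,\nu\|\nabla u(t)\|^2+\frac1{|\Omega|}\,\chi\,(u-G_N\overline u,u)(t),\qquad F=\Big\langle\tfrac1{|\Omega|}\|f\|^2\Big\rangle^{1/2},\qquad U=\Big\langle\tfrac1{|\Omega|}\|u\|^2\Big\rangle^{1/2},$$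 $$L=\min\left\{|\Omega|^{1/3},\ \frac{F}{\langle\frac1{|\Omega|}\|\nabla f\|^2\rangle^{1/2}},\ \frac{F}{\|\nabla f\|_{L^\infty(\Omega)}},\ \frac{F^{1/(N+1)}}{\langle\frac1{|\Omega|}\|Bf\|^2\rangle^{1/(2N+2)}}\right\},$$ $$\mathcal Re=\frac{UL}{\nu},\qquad R_N=\frac{U\,L^{2N+1}}{\chi\,\delta^{2N+2}},$$ where $|\nabla f|^2=\sum_{i,j}|\partial_i f_j|^2$. **Theorem.** The functions $\frac1{|\Omega|}\|u\|^2$ and $\varepsilon(u)$ are integrable on every $[0,T]$ and their averages over $[0,T]$ stay bounded as $T\to\infty$ (so $U$ and $\langle\varepsilon(u)\rangle$ are finite), $U>0$, $L>0$, and the time-averaged energy dissipation rate satisfies $$\langle\varepsilon(u)\rangle\le\Big(2+\frac1{\mathcal Re}+\frac1{R_N}\Big)\frac{U^3}{L}.$$ -/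

import Mathlib

open MeasureTheory Filter Topology
open scoped ContDiff InnerProductSpace Gradient Laplacian

noncomputable section

namespace TRM

/-! ### Positive square roots of operators on a real Hilbert space -/

section SquareRoot

variable {H : Type*} [NormedAddCommGroup H] [InnerProductSpace ℝ H] [CompleteSpace H]

/-- The coefficients of `(1 - √(1 - x)) / x = ∑ n, sqrtCoeff n * x ^ n`. -/
def sqrtCoeff (n : ℕ) : ℝ := catalan n * 2 / 4 ^ (n + 1)

theorem sqrtCoeff_nonneg (n : ℕ) : 0 ≤ sqrtCoeff n := by
  unfold sqrtCoeff; positivity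

theorem sqrtCoeff_zero : sqrtCoeff 0 = 1 / 2 := by
  simp [sqrtCoeff]; norm_num

theorem sqrtCoeff_succ (n : ℕ) : sqrtCoeff (n + 1) =
    (1 / 2) * ∑ p ∈ Finset.HasAntidiagonal.antidiagonal n, sqrtCoeff p.1 * sqrtCoeff p.2 := by
  unfold sqrtCoeff
  rw [catalan_succ', Nat.cast_sum, Finset.sum_mul, Finset.sum_div, Finset.mul_sum]
  refine Finset.sum_congr rfl fun p hp => ?_
  rw [Finset.HasAntidiagonal.mem_antidiagonal] at hp
  subst hp
  push_cast
  field_simp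
  ring

theorem sum_sqrtCoeff_le (m : ℕ) : ∑ n ∈ Finset.range m, sqrtCoeff n ≤ 1 := by
  induction m with
  | zero => simp
  | succ m ih =>
    have h0 : 0 ≤ ∑ n ∈ Finset.range m, sqrtCoeff n :=
      Finset.sum_nonneg fun n _ => sqrtCoeff_nonneg n
    have h1 : ∑ n ∈ Finset.range m, ∑ p ∈ Finset.HasAntidiagonal.antidiagonal n, sqrtCoeff p.1 * sqrtCoeff p.2
        ≤ (∑ n ∈ Finset.range m, sqrtCoeff n) * (∑ n ∈ Finset.range m, sqrtCoeff n) := by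
      rw [Finset.sum_mul_sum, ← Finset.sum_product', ← Finset.sum_biUnion]
      · refine Finset.sum_le_sum_of_subset_of_nonneg ?_ ?_
        · intro p hp
          simp only [Finset.mem_biUnion, Finset.mem_range, Finset.HasAntidiagonal.mem_antidiagonal,
            Finset.mem_product] at hp ⊢
          omega
        · intro p _ _
          exact mul_nonneg (sqrtCoeff_nonneg _) (sqrtCoeff_nonneg _)
      · intro a _ b _ hab
        rw [Function.onFun, Finset.disjoint_left]
        intro p hp hq
        rw [Finset.HasAntidiagonal.mem_antidiagonal] at hp hq
        omega
    rw [Finset.sum_range_succ', sqrtCoeff_zero]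
    simp only [sqrtCoeff_succ]
    rw [← Finset.mul_sum]
    nlinarith

theorem exists_sqrt_one_sub (C : H →L[ℝ] H) (hC : IsSelfAdjoint C) (hn : ‖C‖ ≤ 1) :
    ∃ S : H →L[ℝ] H, S.IsPositive ∧ S * S = 1 - C := by
  rcases subsingleton_or_nontrivial H with hH | hH
  · exact ⟨0, ContinuousLinearMap.isPositive_zero, by ext x; exact Subsingleton.elim _ _⟩
  have hs : Summable sqrtCoeff := summable_of_sum_range_le sqrtCoeff_nonneg sum_sqrtCoeff_le
  have hs1 : ∑' n, sqrtCoeff n ≤ 1 :=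
    Real.tsum_le_of_sum_range_le sqrtCoeff_nonneg sum_sqrtCoeff_le
  have hb : ∀ n, ‖sqrtCoeff n • C ^ n‖ ≤ sqrtCoeff n := fun n => by
    rw [norm_smul, Real.norm_of_nonneg (sqrtCoeff_nonneg n)]
    exact mul_le_of_le_one_right (sqrtCoeff_nonneg n)
      ((norm_pow_le C n).trans (pow_le_one₀ (norm_nonneg _) hn))
  have hsn : Summable fun n => ‖sqrtCoeff n • C ^ n‖ :=
    Summable.of_nonneg_of_le (fun _ => norm_nonneg _) hb hs
  have hsm : Summable fun n => sqrtCoeff n • C ^ n := hsn.of_norm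
  obtain ⟨Z, hZ⟩ : ∃ Z, Z = ∑' n, sqrtCoeff n • C ^ n := ⟨_, rfl⟩
  have hZn : ‖Z‖ ≤ 1 := by
    rw [hZ]
    exact (tsum_of_norm_bounded hs.hasSum hb).trans hs1
  have hcomm : C * Z = Z * C := by
    rw [hZ]
    exact Commute.tsum_right C fun n => ((Commute.refl C).pow_right n).smul_right _
  have hZadj : IsSelfAdjoint Z := by
    have h : HasSum (fun n => star (sqrtCoeff n • C ^ n)) (star Z) := by
      rw [hZ]; exact hsm.hasSum.star
    have h' : (fun n => star (sqrtCoeff n • C ^ n)) = fun n => sqrtCoeff n • C ^ n := by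
      funext n
      rw [star_smul, star_pow, hC.star_eq, star_trivial]
    rw [h'] at h
    exact h.unique (by rw [hZ]; exact hsm.hasSum)
  have hrec : Z = (1 / 2 : ℝ) • (1 + C * (Z * Z)) := by
    have hprod : Z * Z = ∑' n, ∑ p ∈ Finset.HasAntidiagonal.antidiagonal n,
        (sqrtCoeff p.1 • C ^ p.1) * (sqrtCoeff p.2 • C ^ p.2) := by
      rw [hZ]
      exact tsum_mul_tsum_eq_tsum_sum_antidiagonal_of_summable_norm hsn hsn
    have hterm : ∀ n, sqrtCoeff (n + 1) • C ^ (n + 1) = (1 / 2 : ℝ) • (C *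
        ∑ p ∈ Finset.HasAntidiagonal.antidiagonal n, (sqrtCoeff p.1 • C ^ p.1) * (sqrtCoeff p.2 • C ^ p.2)) := by
      intro n
      rw [sqrtCoeff_succ, mul_smul, Finset.sum_smul, Finset.mul_sum]
      congr 1
      refine Finset.sum_congr rfl fun p hp => ?_
      rw [Finset.HasAntidiagonal.mem_antidiagonal] at hp
      rw [smul_mul_smul_comm, ← pow_add, hp, mul_smul_comm, pow_succ']
    have hsa : Summable fun n => ∑ p ∈ Finset.HasAntidiagonal.antidiagonal n,
        (sqrtCoeff p.1 • C ^ p.1) * (sqrtCoeff p.2 • C ^ p.2) :=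
      (summable_norm_sum_mul_antidiagonal_of_summable_norm hsn hsn).of_norm
    conv_lhs => rw [hZ, hsm.tsum_eq_zero_add]
    simp only [hterm]
    rw [Summable.tsum_const_smul _ (hsa.mul_left C), hsa.tsum_mul_left, ← hprod, sqrtCoeff_zero,
      pow_zero, smul_add]
  refine ⟨1 - C * Z, ?_, ?_⟩
  · rw [ContinuousLinearMap.isPositive_def']
    constructor
    · refine (IsSelfAdjoint.one _).sub ?_
      rw [IsSelfAdjoint, star_mul, hC.star_eq, hZadj.star_eq, hcomm]
    · intro x
      have h1 : ‖(C * Z) x‖ ≤ ‖x‖ := by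
        refine ((C * Z).le_opNorm x).trans (mul_le_of_le_one_left (norm_nonneg _) ?_)
        exact (norm_mul_le C Z).trans (mul_le_one₀ hn (norm_nonneg _) hZn)
      have h2 : inner ℝ ((C * Z) x) x ≤ ‖x‖ * ‖x‖ :=
        (real_inner_le_norm _ _).trans (mul_le_mul_of_nonneg_right h1 (norm_nonneg _))
      have h3 : (1 - C * Z).reApplyInnerSelf x = ‖x‖ * ‖x‖ - inner ℝ ((C * Z) x) x := by
        simp [ContinuousLinearMap.reApplyInnerSelf_apply, inner_sub_left, sq]
      rw [h3]; linarith
  · have h2 : (2 : ℝ) • Z = 1 + C * (Z * Z) := by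
      conv_lhs => rw [hrec]
      rw [smul_smul]; norm_num
    have h3 : C * Z * (C * Z) = C * (C * (Z * Z)) := by
      rw [mul_assoc, ← mul_assoc Z C Z, ← hcomm, mul_assoc]
    have h4 : C * (C * (Z * Z)) = (2 : ℝ) • (C * Z) - C := by
      rw [← mul_smul_comm, h2, mul_add, mul_one]; abel
    rw [sub_mul, mul_sub (C * Z), one_mul, mul_one, h3, h4, two_smul]
    abel

theorem isPositive_pow {S : H →L[ℝ] H} (hS : S.IsPositive) (n : ℕ) : (S ^ n).IsPositive := by
  induction n using Nat.strong_induction_on with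
  | _ n ih =>
    match n with
    | 0 => rw [pow_zero]; exact ContinuousLinearMap.isPositive_one
    | 1 => rw [pow_one]; exact hS
    | n + 2 =>
      have h := (ih n (by omega)).conj_adjoint S
      rw [hS.isSelfAdjoint.adjoint_eq] at h
      have h' : S ^ (n + 2) = S ∘L (S ^ n) ∘L S := by
        rw [pow_succ, pow_succ']; rfl
      rw [h']; exact h

end SquareRoot

/-! ### Operators given by the Riesz representation theorem -/

section Riesz

variable {P H : Type*} [NormedAddCommGroup P] [InnerProductSpace ℝ P] [CompleteSpace P]
  [NormedAddCommGroup H] [InnerProductSpace ℝ H] [CompleteSpace H]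

/-- For a closed subspace `K` of `P` and a bounded map `π : P → H`, this is the operator
`φ ↦ π z` on `H`, where `z ∈ K` is the unique element with `(z, w) = (φ, π w)` for all `w ∈ K`. -/
def rieszOp (K : Submodule ℝ P) (hK : IsClosed (K : Set P)) (π : P →L[ℝ] H) : H →L[ℝ] H :=
  haveI : CompleteSpace K := hK.completeSpace_coe
  (π ∘L K.subtypeL) ∘L ContinuousLinearMap.adjoint (π ∘L K.subtypeL)

variable {K : Submodule ℝ P} {hK : IsClosed (K : Set P)} {π : P →L[ℝ] H}

theorem rieszOp_spec (φ v : H) :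
    v = rieszOp K hK π φ ↔ ∃ z ∈ K, π z = v ∧ ∀ w ∈ K, inner ℝ z w = inner ℝ φ (π w) := by
  have : CompleteSpace K := hK.completeSpace_coe
  constructor
  · rintro rfl
    refine ⟨ContinuousLinearMap.adjoint (π ∘L K.subtypeL) φ, Subtype.coe_prop _, rfl, ?_⟩
    intro w hw
    exact ContinuousLinearMap.adjoint_inner_left (π ∘L K.subtypeL) ⟨w, hw⟩ φ
  · rintro ⟨z, hz, rfl, h⟩
    have h1 : ContinuousLinearMap.adjoint (π ∘L K.subtypeL) φ = ⟨z, hz⟩ := by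
      refine ext_inner_right ℝ fun w => ?_
      rw [ContinuousLinearMap.adjoint_inner_left]
      exact (h w w.2).symm
    rw [rieszOp, ContinuousLinearMap.comp_apply, h1]
    rfl

theorem isSelfAdjoint_rieszOp : IsSelfAdjoint (rieszOp K hK π) := by
  have : CompleteSpace K := hK.completeSpace_coe
  exact (ContinuousLinearMap.isPositive_self_comp_adjoint (π ∘L K.subtypeL)).isSelfAdjoint

theorem norm_rieszOp_le (hπ : ∀ z, ‖π z‖ ≤ ‖z‖) : ‖rieszOp K hK π‖ ≤ 1 := by
  have : CompleteSpace K := hK.completeSpace_coe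
  have h : ‖π ∘L K.subtypeL‖ ≤ 1 :=
    ContinuousLinearMap.opNorm_le_bound _ zero_le_one fun z => by
      rw [one_mul]; exact hπ (z : P)
  refine (ContinuousLinearMap.opNorm_comp_le _ _).trans (mul_le_one₀ h (norm_nonneg _) ?_)
  rwa [LinearIsometryEquiv.norm_map]

end Riesz

/-! ### Periodic vector fields on the box `(0, ℓ)³` -/

/-- Three-dimensional Euclidean space. -/
abbrev E3 : Type := EuclideanSpace ℝ (Fin 3)

/-- The `i`-th standard unit vector. -/
abbrev e (i : Fin 3) : E3 := EuclideanSpace.single i 1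

/-- The open periodic box `Ω = (0, ℓ)³`. -/
def box (ℓ : ℝ) : Set E3 := {x | ∀ i, x i ∈ Set.Ioo 0 ℓ}

/-- The volume `|Ω|`. -/
def vol (ℓ : ℝ) : ℝ := volume.real (box ℓ)

/-- Lebesgue measure on `Ω`. -/
abbrev boxMeasure (ℓ : ℝ) : Measure E3 := volume.restrict (box ℓ)

theorem isBounded_box (ℓ : ℝ) : Bornology.IsBounded (box ℓ) := by
  have h := (Metric.isBounded_Icc (0 : Fin 3 → ℝ) (fun _ => ℓ))
  have h2 := (EuclideanSpace.equiv (Fin 3) ℝ).symm.lipschitz.isBounded_image h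
  refine h2.subset fun x hx => ?_
  exact ⟨(EuclideanSpace.equiv (Fin 3) ℝ) x, ⟨fun i => (hx i).1.le, fun i => (hx i).2.le⟩, by simp⟩

theorem measurableSet_box (ℓ : ℝ) : MeasurableSet (box ℓ) := by
  have h : box ℓ = ⋂ i : Fin 3, (fun x : E3 => x i) ⁻¹' Set.Ioo 0 ℓ := by
    ext x; simp [box]
  rw [h]
  exact MeasurableSet.iInter fun i => measurableSet_Ioo.preimage (by fun_prop)

instance isFiniteMeasure_boxMeasure (ℓ : ℝ) : IsFiniteMeasure (boxMeasure ℓ) :=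
  ⟨by rw [Measure.restrict_apply_univ]; exact (isBounded_box ℓ).measure_lt_top⟩

theorem memLp_of_continuous (ℓ : ℝ) {F : Type*} [NormedAddCommGroup F] {v : E3 → F}
    (hv : Continuous v) (p : ENNReal) : MemLp v p (boxMeasure ℓ) := by
  have hK : IsCompact (closure (box ℓ)) := (isBounded_box ℓ).isCompact_closure
  obtain ⟨C, hC⟩ := hK.exists_bound_of_continuousOn hv.continuousOn
  refine MemLp.of_bound hv.aestronglyMeasurable C ?_
  exact ae_restrict_of_forall_mem (measurableSet_box ℓ) fun x hx => hC x (subset_closure hx)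

/-- The space `L²(Ω)` of square integrable vector fields on the box. -/
abbrev L2 (ℓ : ℝ) : Type := Lp E3 2 (boxMeasure ℓ)

/-- Triples of `L²` vector fields, used for gradients: the `i`-th entry plays the role of
`∂u/∂xᵢ`, and `‖g‖² = ∑ i, ‖g i‖²`. -/
abbrev L2Grad (ℓ : ℝ) : Type := PiLp 2 (fun _ : Fin 3 => L2 ℓ)

/-- `v` is periodic with period `ℓ` in each coordinate direction. -/
def IsPeriodic (ℓ : ℝ) {F : Type*} (v : E3 → F) : Prop :=
  ∀ (j : Fin 3) (x : E3), v (x + ℓ • e j) = v x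

/-- Smooth `ℓ`-periodic vector fields on `ℝ³`. -/
structure SmoothField (ℓ : ℝ) where
  toFun : E3 → E3
  smooth : ContDiff ℝ ∞ toFun
  periodic : IsPeriodic ℓ toFun

instance (ℓ : ℝ) : CoeFun (SmoothField ℓ) (fun _ => E3 → E3) := ⟨SmoothField.toFun⟩

/-- The partial derivative `∂φ/∂xᵢ` of a smooth periodic field. -/
def SmoothField.pderiv {ℓ : ℝ} (φ : SmoothField ℓ) (i : Fin 3) : SmoothField ℓ where
  toFun x := fderiv ℝ φ x (e i)
  smooth := (φ.smooth.fderiv_right (m := ∞) (by simp)).clm_apply contDiff_const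
  periodic j x := by
    have h : (fun y => φ (y + ℓ • e j)) = φ := funext fun y => φ.periodic j y
    have h2 := fderiv_comp_add_right (𝕜 := ℝ) (f := φ.toFun) (x := x) (ℓ • e j)
    rw [h] at h2
    exact congrArg (fun A : E3 →L[ℝ] E3 => A (e i)) h2.symm

/-- The class in `L²(Ω)` of a smooth periodic field. -/
def SmoothField.toL2 {ℓ : ℝ} (φ : SmoothField ℓ) : L2 ℓ :=
  (memLp_of_continuous ℓ φ.smooth.continuous 2).toLp φ

/-- The gradient of a smooth periodic field, as a triple of `L²` fields. -/
def SmoothField.grad {ℓ : ℝ} (φ : SmoothField ℓ) : L2Grad ℓ :=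
  WithLp.toLp 2 fun i => (φ.pderiv i).toL2

/-- The divergence of a vector field. -/
def divergence (v : E3 → E3) (x : E3) : ℝ := ∑ i, fderiv ℝ v x (e i) i

/-- A vector field on the box has mean zero. -/
def MeanZero (ℓ : ℝ) (v : E3 → E3) : Prop := ∫ x in box ℓ, v x = 0

/-- The triple `g` is the weak periodic gradient of `v`: this says that `v` belongs to the
periodic Sobolev space `H¹` and `g i = ∂v/∂xᵢ`. -/
def IsWeakGradient {ℓ : ℝ} (v : L2 ℓ) (g : L2Grad ℓ) : Prop :=
  ∀ (φ : SmoothField ℓ) (i : Fin 3), inner ℝ v (φ.pderiv i).toL2 = -inner ℝ (g i) φ.toL2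

/-! ### The differential filter and van Cittert deconvolution -/

/-- The closed space of pairs `(v, δ∇v)` with `v` in the periodic Sobolev space `H¹`; the inner
product of `(v, δ∇v)` and `(w, δ∇w)` is `(v, w) + δ²(∇v, ∇w)`. -/
def scaledH1 (ℓ δ : ℝ) : Submodule ℝ (WithLp 2 (L2 ℓ × L2Grad ℓ)) where
  carrier := {z | ∀ (φ : SmoothField ℓ) (i : Fin 3),
    δ * inner ℝ z.fst (φ.pderiv i).toL2 = -inner ℝ (z.snd i) φ.toL2}
  zero_mem' φ i := by simp
  add_mem' := by
    intro z w hz hw φ i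
    have := hz φ i
    have := hw φ i
    simp only [WithLp.add_fst, WithLp.add_snd, PiLp.add_apply, inner_add_left]
    linarith
  smul_mem' := by
    intro c z hz φ i
    have := hz φ i
    simp only [WithLp.smul_fst, WithLp.smul_snd, PiLp.smul_apply, real_inner_smul_left]
    linear_combination c * this

theorem mem_scaledH1_iff {ℓ δ : ℝ} (hδ : δ ≠ 0) (z : WithLp 2 (L2 ℓ × L2Grad ℓ)) :
    z ∈ scaledH1 ℓ δ ↔ ∃ g : L2Grad ℓ, IsWeakGradient z.fst g ∧ z.snd = δ • g := by
  constructor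
  · intro hz
    refine ⟨δ⁻¹ • z.snd, fun φ i => ?_, by rw [smul_smul, mul_inv_cancel₀ hδ, one_smul]⟩
    have := hz φ i
    rw [PiLp.smul_apply, real_inner_smul_left]
    field_simp
    linarith
  · rintro ⟨g, hg, hz⟩ φ i
    rw [hz, hg φ i, PiLp.smul_apply, real_inner_smul_left]
    ring

theorem isClosed_scaledH1 (ℓ δ : ℝ) :
    IsClosed (scaledH1 ℓ δ : Set (WithLp 2 (L2 ℓ × L2Grad ℓ))) := by
  have h : (scaledH1 ℓ δ : Set (WithLp 2 (L2 ℓ × L2Grad ℓ))) =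
      ⋂ (φ : SmoothField ℓ) (i : Fin 3),
        {z | δ * inner ℝ z.fst (φ.pderiv i).toL2 = -inner ℝ (z.snd i) φ.toL2} := by
    ext z; simp [scaledH1]
  rw [h]
  refine isClosed_iInter fun φ => isClosed_iInter fun i => isClosed_eq ?_ ?_ <;> fun_prop

/-- The differential filter `G = (I - δ²Δ)⁻¹`: `G φ` is the unique `v` in the periodic space `H¹`
with `(v, w) + δ²(∇v, ∇w) = (φ, w)` for all `w` in `H¹` (see `diffFilter_spec`). -/
def diffFilter (ℓ δ : ℝ) : L2 ℓ →L[ℝ] L2 ℓ :=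
  rieszOp (P := WithLp 2 (L2 ℓ × L2Grad ℓ)) (scaledH1 ℓ δ) (isClosed_scaledH1 ℓ δ)
    (WithLp.fstL 2 ℝ (L2 ℓ) (L2Grad ℓ))

theorem diffFilter_spec {ℓ δ : ℝ} (hδ : δ ≠ 0) (φ v : L2 ℓ) :
    v = diffFilter ℓ δ φ ↔ ∃ g : L2Grad ℓ, IsWeakGradient v g ∧
      ∀ (w : L2 ℓ) (h : L2Grad ℓ), IsWeakGradient w h →
        inner ℝ v w + δ ^ 2 * inner ℝ g h = inner ℝ φ w := by
  have h2 : ∀ g h : L2Grad ℓ, inner ℝ (δ • g) (δ • h) = δ ^ 2 * inner ℝ g h := fun g h => by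
    rw [real_inner_smul_left, real_inner_smul_right]; ring
  rw [diffFilter, rieszOp_spec]
  constructor
  · rintro ⟨z, hz, rfl, hw⟩
    obtain ⟨g, hg, hzg⟩ := (mem_scaledH1_iff hδ _).1 hz
    refine ⟨g, hg, fun w h hwh => ?_⟩
    have := hw (WithLp.toLp 2 (w, δ • h)) ((mem_scaledH1_iff hδ _).2 ⟨h, hwh, rfl⟩)
    rw [WithLp.prod_inner_apply] at this
    rw [← h2, ← hzg]
    exact this
  · rintro ⟨g, hg, hv⟩
    refine ⟨WithLp.toLp 2 (v, δ • g), (mem_scaledH1_iff hδ _).2 ⟨g, hg, rfl⟩, rfl, ?_⟩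
    intro w hw
    obtain ⟨h, hh, hwh⟩ := (mem_scaledH1_iff hδ _).1 hw
    have h3 := hv _ h hh
    rw [← h2, ← hwh] at h3
    rw [WithLp.prod_inner_apply]
    exact h3

/-- The van Cittert deconvolution operator `G_N` of a filter `G`: it maps `φ̄` to the `N`-th
iterate of `φ₀ = φ̄`, `φₙ₊₁ = φₙ + (φ̄ - G φₙ)`. -/
def vanCittert {ℓ : ℝ} (G : L2 ℓ →L[ℝ] L2 ℓ) : ℕ → L2 ℓ →L[ℝ] L2 ℓ
  | 0 => 1
  | n + 1 => vanCittert G n + (1 - G * vanCittert G n)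

/-- The generalized fluctuation operator `u ↦ u - G_N ū`, where `ū = G u`. -/
def fluctuation (ℓ δ : ℝ) (N : ℕ) : L2 ℓ →L[ℝ] L2 ℓ :=
  1 - vanCittert (diffFilter ℓ δ) N * diffFilter ℓ δ

theorem fluctuation_eq_pow (ℓ δ : ℝ) (N : ℕ) :
    fluctuation ℓ δ N = (1 - diffFilter ℓ δ) ^ (N + 1) := by
  unfold fluctuation
  induction N with
  | zero => simp [vanCittert]
  | succ N ih =>
    rw [pow_succ', ← ih, vanCittert]
    noncomm_ring

theorem norm_diffFilter_le (ℓ δ : ℝ) : ‖diffFilter ℓ δ‖ ≤ 1 :=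
  norm_rieszOp_le fun z => WithLp.norm_fst_le _ z

theorem isSelfAdjoint_diffFilter (ℓ δ : ℝ) : IsSelfAdjoint (diffFilter ℓ δ) :=
  isSelfAdjoint_rieszOp

theorem exists_sqrt_fluctuation (ℓ δ : ℝ) (N : ℕ) : ∃ B : L2 ℓ →L[ℝ] L2 ℓ, B.IsPositive ∧
    B * B = (δ ^ (2 * N + 2))⁻¹ • fluctuation ℓ δ N := by
  obtain ⟨S, hS, hSS⟩ := exists_sqrt_one_sub (diffFilter ℓ δ)
    (isSelfAdjoint_diffFilter ℓ δ) (norm_diffFilter_le ℓ δ)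
  refine ⟨|(δ ^ (N + 1))⁻¹| • S ^ (N + 1), (isPositive_pow hS _).smul_of_nonneg (abs_nonneg _), ?_⟩
  rw [fluctuation_eq_pow, ← hSS, smul_mul_smul_comm, abs_mul_abs_self, ← pow_add,
    ← mul_inv, ← pow_add, ← sq S, ← pow_mul, show N + 1 + (N + 1) = 2 * N + 2 by ring,
    show 2 * (N + 1) = 2 * N + 2 by ring]

/-- The operator `B = δ^{-(N+1)} √(I - G_N G)`, the positive square root of
`δ^{-(2N+2)} (I - G_N G)`. -/
def opB (ℓ δ : ℝ) (N : ℕ) : L2 ℓ →L[ℝ] L2 ℓ := (exists_sqrt_fluctuation ℓ δ N).choose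

theorem opB_spec (ℓ δ : ℝ) (N : ℕ) : (opB ℓ δ N).IsPositive ∧
    opB ℓ δ N * opB ℓ δ N = (δ ^ (2 * N + 2))⁻¹ • fluctuation ℓ δ N :=
  (exists_sqrt_fluctuation ℓ δ N).choose_spec

/-! ### Solutions of the time relaxation model -/

/-- Smooth periodic data (forces, initial velocities, test fields) that are divergence free and
have mean zero. -/
def SmoothField.IsSolenoidal {ℓ : ℝ} (φ : SmoothField ℓ) : Prop :=
  (∀ x, divergence φ x = 0) ∧ MeanZero ℓ φ

/-- The trilinear term `(u ⊗ u, ∇φ) = ∫ ∑ i j, uᵢ uⱼ ∂φⱼ/∂xᵢ dx`. -/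
def convection {ℓ : ℝ} (u : L2 ℓ) (φ : SmoothField ℓ) : ℝ :=
  ∫ x in box ℓ, inner ℝ (fderiv ℝ φ x (u x)) (u x)

/-- `u` is a Leray-Hopf weak solution on `[0, ∞)`, with weak gradient `Du`, of the time relaxation
model
`u_t + u·∇u - νΔu + ∇p + χ(u - G_N ū) = f`, `∇·u = 0`, `u(0) = u₀`
in the periodic box. -/
structure IsLerayHopfSolution (ℓ ν χ δ : ℝ) (N : ℕ) (f u₀ : SmoothField ℓ)
    (u : ℝ → L2 ℓ) (Du : ℝ → L2Grad ℓ) : Prop where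
  /-- `u ∈ L^∞(0, T; L²)` -/
  memLp_u : ∀ T > 0, MemLp u ⊤ (volume.restrict (Set.Ioc 0 T))
  /-- `∇u ∈ L²(0, T; L²)` -/
  memLp_Du : ∀ T > 0, MemLp Du 2 (volume.restrict (Set.Ioc 0 T))
  /-- `u(t)` lies in the periodic space `H¹` and has gradient `Du t` -/
  weakGradient : ∀ᵐ t ∂volume.restrict (Set.Ioi 0), IsWeakGradient (u t) (Du t)
  /-- incompressibility -/
  divFree : ∀ᵐ t ∂volume.restrict (Set.Ioi 0), ∀ᵐ x ∂boxMeasure ℓ, ∑ i, (Du t i) x i = 0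
  meanZero : ∀ᵐ t ∂volume.restrict (Set.Ioi 0), MeanZero ℓ (u t)
  /-- the weak form of the equation, including the initial condition -/
  weakForm : ∀ φ : SmoothField ℓ, φ.IsSolenoidal → ∀ᵐ t ∂volume.restrict (Set.Ioi 0),
    inner ℝ (u t) φ.toL2 + ∫ s in (0 : ℝ)..t,
        (ν * inner ℝ (Du s) φ.grad - convection (u s) φ
          + χ * inner ℝ (fluctuation ℓ δ N (u s)) φ.toL2)
      = inner ℝ u₀.toL2 φ.toL2 + ∫ _s in (0 : ℝ)..t, inner ℝ f.toL2 φ.toL2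
  /-- the energy inequality -/
  energy : ∀ᵐ t ∂volume.restrict (Set.Ioi 0),
    (1 / 2) * ‖u t‖ ^ 2 + ∫ s in (0 : ℝ)..t,
        (ν * ‖Du s‖ ^ 2 + χ * inner ℝ (fluctuation ℓ δ N (u s)) (u s))
      ≤ (1 / 2) * ‖u₀.toL2‖ ^ 2 + ∫ s in (0 : ℝ)..t, inner ℝ f.toL2 (u s)

/-- `u` is (the curve in `L²(Ω)` given by) a classical solution `w` on `[0, ∞)`, with gradient `Du`
and pressure `p`, of the time relaxation model with initial velocity `u₀`. No energy relation is
part of this definition. -/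
structure IsClassicalSolution (ℓ ν χ δ : ℝ) (N : ℕ) (f u₀ : SmoothField ℓ)
    (u : ℝ → L2 ℓ) (Du : ℝ → L2Grad ℓ) (w : ℝ → E3 → E3) (p : ℝ → E3 → ℝ) : Prop where
  u_eq : ∀ t ≥ 0, u t =ᵐ[boxMeasure ℓ] w t
  Du_eq : ∀ t > 0, ∀ i, Du t i =ᵐ[boxMeasure ℓ] fun x => fderiv ℝ (w t) x (e i)
  initial : w 0 = u₀
  periodic_w : ∀ t ≥ 0, IsPeriodic ℓ (w t)
  periodic_p : ∀ t > 0, IsPeriodic ℓ (p t)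
  continuous_w : ContinuousOn (fun z : ℝ × E3 => w z.1 z.2) (Set.Ici 0 ×ˢ Set.univ)
  contDiff_w : ∀ t > 0, ContDiff ℝ 2 (w t)
  contDiff_p : ∀ t > 0, ContDiff ℝ 1 (p t)
  differentiable_t : ∀ t > 0, ∀ x, DifferentiableAt ℝ (fun s => w s x) t
  continuous_dt : ContinuousOn (fun z : ℝ × E3 => deriv (fun s => w s z.2) z.1)
    (Set.Ioi 0 ×ˢ Set.univ)
  continuous_dx : ContinuousOn (fun z : ℝ × E3 => fderiv ℝ (w z.1) z.2) (Set.Ioi 0 ×ˢ Set.univ)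
  continuous_dxx : ContinuousOn (fun z : ℝ × E3 => iteratedFDeriv ℝ 2 (w z.1) z.2)
    (Set.Ioi 0 ×ˢ Set.univ)
  divFree : ∀ t > 0, ∀ x, divergence (w t) x = 0
  meanZero : ∀ t > 0, MeanZero ℓ (w t)
  equation : ∀ t > 0, ∀ᵐ x ∂boxMeasure ℓ,
    deriv (fun s => w s x) t + fderiv ℝ (w t) x (w t x) - ν • (Δ (w t)) x + (∇ (p t)) x
      + χ • fluctuation ℓ δ N (u t) x = f x

/-- `u`, with gradient `Du`, is a mean-zero solution of the time relaxation model: a Leray-Hopf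
weak solution or a classical solution. -/
def IsSolution (ℓ ν χ δ : ℝ) (N : ℕ) (f u₀ : SmoothField ℓ)
    (u : ℝ → L2 ℓ) (Du : ℝ → L2Grad ℓ) : Prop :=
  IsLerayHopfSolution ℓ ν χ δ N f u₀ u Du ∨ ∃ w p, IsClassicalSolution ℓ ν χ δ N f u₀ u Du w p

/-! ### Time averages, scales and the energy dissipation rate -/

/-- The average of `ψ` over `[0, T]`. -/
def avg (ψ : ℝ → ℝ) (T : ℝ) : ℝ := (1 / T) * ∫ t in (0 : ℝ)..T, ψ t

/-- The long time average `⟨ψ⟩ = limsup_{T → ∞} (1/T) ∫₀ᵀ ψ dt`. -/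
def timeAvg (ψ : ℝ → ℝ) : ℝ := limsup (avg ψ) atTop

/-- The long time average of the nonnegative function `ψ` is a well-defined finite number: `ψ` is
integrable on each `[0, T]` and its averages are bounded as `T → ∞`. -/
def HasTimeAvg (ψ : ℝ → ℝ) : Prop :=
  (∀ T > 0, IntervalIntegrable ψ volume 0 T) ∧ IsBoundedUnder (· ≤ ·) atTop (avg ψ)

/-- The energy dissipation rate
`ε = |Ω|⁻¹ ∫ ν|∇u|² dx + |Ω|⁻¹ ∫ χ(u - G_N ū)·u dx` as a function of time. -/
def dissipation (ℓ ν χ δ : ℝ) (N : ℕ) (u : ℝ → L2 ℓ) (Du : ℝ → L2Grad ℓ) (t : ℝ) : ℝ :=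
  (1 / vol ℓ) * (ν * ‖Du t‖ ^ 2)
    + (1 / vol ℓ) * (χ * inner ℝ (fluctuation ℓ δ N (u t)) (u t))

/-- Twice the kinetic energy per unit volume, `|Ω|⁻¹ ‖u‖²`, as a function of time. -/
def meanSquare {ℓ : ℝ} (u : ℝ → L2 ℓ) (t : ℝ) : ℝ := (1 / vol ℓ) * ‖u t‖ ^ 2

/-- The scale `F = ⟨|Ω|⁻¹ ‖f‖²⟩^{1/2}` of the body force. -/
def forceScale {ℓ : ℝ} (f : SmoothField ℓ) : ℝ := √(timeAvg (meanSquare fun _ => f.toL2))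

/-- The large scale velocity `U = ⟨|Ω|⁻¹ ‖u‖²⟩^{1/2}`. -/
def velocityScale {ℓ : ℝ} (u : ℝ → L2 ℓ) : ℝ := √(timeAvg (meanSquare u))

/-- `‖∇f‖_{L^∞}` for the time-independent force `f`, with `|∇f|² = ∑ i j, |∂fⱼ/∂xᵢ|²`. -/
def gradSup {ℓ : ℝ} (f : SmoothField ℓ) : ℝ :=
  (eLpNorm (fun x => √(∑ i, ‖f.pderiv i x‖ ^ 2)) ⊤ (boxMeasure ℓ)).toReal

/-- The large scale length: the minimum of `|Ω|^{1/3}`, `F / ⟨|Ω|⁻¹ ‖∇f‖²⟩^{1/2}`,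
`F / ‖∇f‖_{L^∞}` and `F^{1/(N+1)} / ⟨|Ω|⁻¹ ‖Bf‖²⟩^{1/(2N+2)}`. -/
def lengthScale {ℓ : ℝ} (δ : ℝ) (N : ℕ) (f : SmoothField ℓ) : ℝ :=
  min (min (vol ℓ ^ (1 / 3 : ℝ))
      (forceScale f / √(timeAvg fun _ => (1 / vol ℓ) * ‖f.grad‖ ^ 2)))
    (min (forceScale f / gradSup f)
      (forceScale f ^ (1 / (N + 1) : ℝ) /
        (timeAvg (meanSquare fun _ => opB ℓ δ N f.toL2)) ^ (1 / (2 * N + 2) : ℝ)))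

/-- The Reynolds number `Re = U L / ν`. -/
def reynolds (U L ν : ℝ) : ℝ := U * L / ν

/-- The dimensionless relaxation parameter `R_N = U L^{2N+1} / (χ δ^{2N+2})`. -/
def relaxationNumber (U L χ δ : ℝ) (N : ℕ) : ℝ := U * L ^ (2 * N + 1) / (χ * δ ^ (2 * N + 2))

end TRM
end

noncomputable section

namespace TRM

/-! ### Integrals of periodic functions over the box -/

section Periodic

variable {ℓ : ℝ} {F : Type*}

/-! Write E for the averaged dissipation. The energy inequality and Young's inequality give E ≤
αF²/2 + U²/(2α) for every α > 0, so E ≤ FU at α = U/F. A bound on FU in the other direction comes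
from testing the weak equation with f itself. The viscous and relaxation terms are positive
semidefinite forms, the latter because I - G_N G = δ^{2N+2}B². Young's inequality with one common
parameter β therefore bounds them by (β/2)ε + M/(2β), where M = |Ω|⁻¹(ν‖∇f‖² + χδ^{2N+2}‖Bf‖²). The
convective term is at most ‖∇f‖_∞‖u‖², and the boundary term (u(T), f) is negligible against T.
Hence F² ≤ M/(2β) + βE/2 + ‖∇f‖_∞U².

The length L is built so that ‖∇f‖_∞ ≤ F/L and M ≤ F²m with m = ν/L² + χδ^{2N+2}/L^{2N+2}. With β =
F/U this becomes FU ≤ E/2 + U³/L + U²m/2. Inserting it into E ≤ FU and absorbing E/2 gives the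
claim. Free parameters α and β replace the Cauchy–Schwarz inequality for time averages. The two
estimates are `IsLerayHopfSolution.energy_le` and `IsLerayHopfSolution.weak_le`; they are averaged
in `timeAvg_bounds` and combined in `dissipation_bound`.

The averages are finite because the Poincaré inequality `IsWeakGradient.norm_le` lets the
dissipation absorb the work of the force. If U were 0, then E ≤ 0, and the second estimate fails for
large β. L is positive because Bf ≠ 0: the kernel of I - G consists of constants
(`eq_zero_of_opB_eq_zero`).

Classical solutions are shown to be Leray–Hopf solutions. The delicate point is integrability near t
= 0, where no control of the derivatives is assumed; see `IsClassicalSolution.energy_identity`. -/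

theorem isOpen_box (ℓ : ℝ) : IsOpen (box ℓ) := by
  have h : box ℓ = ⋂ i : Fin 3, (fun x : E3 => x i) ⁻¹' Set.Ioo 0 ℓ := by
    ext x; simp [box]
  rw [h]
  exact isOpen_iInter_of_finite fun i => isOpen_Ioo.preimage (by fun_prop)

/-- The basis `ℓ e₀, ℓ e₁, ℓ e₂` of the period lattice. -/
def periodBasis (hℓ : 0 < ℓ) : Module.Basis (Fin 3) ℝ E3 :=
  (EuclideanSpace.basisFun (Fin 3) ℝ).toBasis.unitsSMul fun _ => Units.mk0 ℓ hℓ.ne'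

theorem periodBasis_apply (hℓ : 0 < ℓ) (i : Fin 3) : periodBasis hℓ i = ℓ • e i := by
  simp [periodBasis, Module.Basis.unitsSMul_apply, Units.smul_def]

theorem periodBasis_repr (hℓ : 0 < ℓ) (x : E3) (i : Fin 3) :
    (periodBasis hℓ).repr x i = ℓ⁻¹ * x i := by
  simp [periodBasis, Module.Basis.repr_unitsSMul, Units.smul_def]

/-- The two sets differ only in faces, which are null. This gives access to the theory of
fundamental domains of lattices. -/
theorem box_ae_eq_fundamentalDomain (hℓ : 0 < ℓ) :
    box ℓ =ᵐ[volume] ZSpan.fundamentalDomain (periodBasis hℓ) := by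
  have h1 : box ℓ = (WithLp.ofLp : E3 → Fin 3 → ℝ) ⁻¹'
      Set.pi Set.univ fun _ => Set.Ioo 0 ℓ := by
    ext x; simp [box]
  have h2 : ZSpan.fundamentalDomain (periodBasis hℓ) = (WithLp.ofLp : E3 → Fin 3 → ℝ) ⁻¹'
      Set.pi Set.univ fun _ => Set.Ico 0 ℓ := by
    ext x
    simp only [ZSpan.mem_fundamentalDomain, periodBasis_repr, Set.mem_Ico, Set.mem_preimage,
      Set.mem_pi, Set.mem_univ, forall_const]
    refine forall_congr' fun i => ?_
    rw [inv_mul_lt_iff₀ hℓ, mul_one, mul_nonneg_iff_of_pos_left (inv_pos.2 hℓ)]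
  rw [h1, h2]
  refine (PiLp.volume_preserving_ofLp (Fin 3)).quasiMeasurePreserving.preimage_ae_eq ?_
  exact Measure.pi_Ioo_ae_eq_pi_Icc.trans Measure.pi_Ico_ae_eq_pi_Icc.symm

theorem IsPeriodic.add_mem_span {v : E3 → F} (hv : IsPeriodic ℓ v) (hℓ : 0 < ℓ) {g : E3}
    (hg : g ∈ Submodule.span ℤ (Set.range (periodBasis hℓ))) (x : E3) : v (x + g) = v x := by
  induction hg using Submodule.span_induction generalizing x with
  | mem g hg =>
    obtain ⟨i, rfl⟩ := hg
    rw [periodBasis_apply]; exact hv i x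
  | zero => simp
  | add a b _ _ ha hb => rw [← add_assoc, hb, ha]
  | smul n a _ ha =>
    induction n using Int.induction_on generalizing x with
    | zero => simp
    | succ n ih => rw [add_smul, one_smul, ← add_assoc, ha, ih]
    | pred n ih => rw [← ha, sub_smul, one_smul, add_assoc, sub_add_cancel, ih]

variable [NormedAddCommGroup F] [NormedSpace ℝ F]

open scoped Pointwise in
-- A translate of a fundamental domain is again a fundamental domain, and a periodic function has
-- the same integral over both.
theorem setIntegral_box_add (hℓ : 0 < ℓ) {h : E3 → F} (hh : IsPeriodic ℓ h) (y : E3) :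
    ∫ x in box ℓ, h (x + y) = ∫ x in box ℓ, h x := by
  have h0 := ZSpan.isAddFundamentalDomain' (periodBasis hℓ) (volume : Measure E3)
  rw [setIntegral_congr_set (box_ae_eq_fundamentalDomain hℓ),
    setIntegral_congr_set (box_ae_eq_fundamentalDomain hℓ)]
  set D := ZSpan.fundamentalDomain (periodBasis hℓ)
  have : Countable (Submodule.span ℤ (Set.range (periodBasis hℓ))).toAddSubgroup :=
    inferInstanceAs (Countable (Submodule.span ℤ (Set.range (periodBasis hℓ))))
  have h2 := h0.setIntegral_eq (h0.vadd_of_comm y) (f := h) fun g x => by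
    rw [AddSubgroup.vadd_def, vadd_eq_add, add_comm]; exact hh.add_mem_span hℓ g.2 x
  rw [h2, ← (measurePreserving_add_right (volume : Measure E3) y).setIntegral_preimage_emb
    (MeasurableEquiv.addRight y).measurableEmbedding h (y +ᵥ D)]
  congr 2
  ext x
  rw [Set.mem_preimage, add_comm, ← vadd_eq_add, Set.vadd_mem_vadd_set_iff]

end Periodic

/-! ### Curves in `L²` of the box -/

section Curves

variable {ℓ : ℝ} {F : Type*} [NormedAddCommGroup F]

theorem isCompact_closure_box (ℓ : ℝ) : IsCompact (closure (box ℓ)) :=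
  (isBounded_box ℓ).isCompact_closure

/-- The norm of the inclusion of bounded functions into `L²` of the box. -/
def boxConst (ℓ : ℝ) : ℝ := (measureUnivNNReal (boxMeasure ℓ) : ℝ) ^ (ENNReal.toReal 2)⁻¹

theorem boxConst_nonneg (ℓ : ℝ) : 0 ≤ boxConst ℓ := by
  unfold boxConst; positivity

theorem norm_le_boxConst_mul {z : Lp F 2 (boxMeasure ℓ)} {Z : E3 → F} {C : ℝ} (hC : 0 ≤ C)
    (hz : z =ᵐ[boxMeasure ℓ] Z) (hZ : ∀ x ∈ closure (box ℓ), ‖Z x‖ ≤ C) :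
    ‖z‖ ≤ boxConst ℓ * C := by
  refine Lp.norm_le_of_ae_bound hC ?_
  filter_upwards [hz, ae_restrict_mem (measurableSet_box ℓ)] with x hx hxb
  rw [hx]; exact hZ x (subset_closure hxb)

/-- Joint continuity is uniform in x over the compact closure of the box, and on a bounded box the
sup norm dominates the L² norm. -/
theorem continuousOn_curve {I : Set ℝ} {W : ℝ → E3 → F}
    (hW : ContinuousOn (fun z : ℝ × E3 => W z.1 z.2) (I ×ˢ Set.univ))
    {v : ℝ → Lp F 2 (boxMeasure ℓ)} (hv : ∀ s ∈ I, v s =ᵐ[boxMeasure ℓ] W s) :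
    ContinuousOn v I := by
  intro t ht
  rw [ContinuousWithinAt, Metric.tendsto_nhds]
  intro ε hε
  -- The added 1 keeps the quotient meaningful if the constant is 0 and makes the final inequality
  -- strict.
  have hη : 0 < ε / (boxConst ℓ + 1) := div_pos hε (by linarith [boxConst_nonneg ℓ])
  obtain ⟨V, hV, hVu⟩ := (isCompact_closure_box ℓ).mem_uniformity_of_prod (f := W)
    (hW.mono (Set.prod_mono_right (Set.subset_univ _))) ht (Metric.dist_mem_uniformity hη)
  filter_upwards [hV, self_mem_nhdsWithin] with s hs hsI
  rw [dist_eq_norm]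
  refine (norm_le_boxConst_mul hη.le ((Lp.coeFn_sub _ _).trans ((hv s hsI).sub (hv t ht)))
    fun x hx => ?_).trans_lt ?_
  · have := hVu s hs x hx
    rw [Set.mem_ofPred_eq, dist_eq_norm] at this
    exact this.le
  · rw [← mul_div_assoc, div_lt_iff₀ (by linarith [boxConst_nonneg ℓ])]
    nlinarith

/-- The mean value inequality is applied for each x to s ↦ W s x - s • W' t x, whose derivative W' s
x - W' t x is small uniformly in x. -/
theorem hasDerivAt_curve [NormedSpace ℝ F] {I : Set ℝ} (hI : IsOpen I) {W W' : ℝ → E3 → F}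
    (hd : ∀ s ∈ I, ∀ x, HasDerivAt (fun s => W s x) (W' s x) s)
    (hW' : ContinuousOn (fun z : ℝ × E3 => W' z.1 z.2) (I ×ˢ Set.univ))
    {v v' : ℝ → Lp F 2 (boxMeasure ℓ)} (hv : ∀ s ∈ I, v s =ᵐ[boxMeasure ℓ] W s)
    (hv' : ∀ s ∈ I, v' s =ᵐ[boxMeasure ℓ] W' s) {t : ℝ} (ht : t ∈ I) :
    HasDerivAt v (v' t) t := by
  rw [hasDerivAt_iff_isLittleO, Asymptotics.isLittleO_iff]
  intro ε hε
  have hη : 0 < ε / (boxConst ℓ + 1) := div_pos hε (by linarith [boxConst_nonneg ℓ])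
  obtain ⟨V, hV, hVu⟩ := (isCompact_closure_box ℓ).mem_uniformity_of_prod (f := W')
    (hW'.mono (Set.prod_mono_right (Set.subset_univ _))) ht (Metric.dist_mem_uniformity hη)
  rw [hI.nhdsWithin_eq ht] at hV
  obtain ⟨r, hr, hrV⟩ := Metric.mem_nhds_iff.1 (inter_mem hV (hI.mem_nhds ht))
  filter_upwards [Metric.ball_mem_nhds t hr] with s hs
  have hsI := (hrV hs).2
  have hae : (v s - v t - (s - t) • v' t : Lp F 2 (boxMeasure ℓ)) =ᵐ[boxMeasure ℓ]
      fun x => W s x - W t x - (s - t) • W' t x := by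
    filter_upwards [Lp.coeFn_sub (v s - v t) ((s - t) • v' t), Lp.coeFn_sub (v s) (v t),
      Lp.coeFn_smul (s - t) (v' t), hv s hsI, hv t ht, hv' t ht] with x h1 h2 h3 h4 h5 h6
    rw [h1, Pi.sub_apply, h2, Pi.sub_apply, h3, Pi.smul_apply, h4, h5, h6]
  refine (norm_le_boxConst_mul (C := ε / (boxConst ℓ + 1) * ‖s - t‖) (by positivity) hae
    fun x hx => ?_).trans ?_
  · have hmv := (convex_ball t r).norm_image_sub_le_of_norm_hasDerivWithin_le
      (f := fun s => W s x - s • W' t x) (f' := fun s => W' s x - W' t x) (x := t) (y := s)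
      (C := ε / (boxConst ℓ + 1)) (fun q hq => ?_) (fun q hq => ?_)
      (Metric.mem_ball_self hr) hs
    · convert! hmv using 2
      rw [sub_smul]; abel
    · have := (hd q (hrV hq).2 x).sub ((hasDerivAt_id q).smul_const (W' t x))
      simp only [one_smul] at this
      exact this.hasDerivWithinAt
    · have := hVu q (hrV hq).1 x hx
      rw [Set.mem_ofPred_eq, dist_eq_norm] at this
      exact this.le
  · rw [← mul_assoc]
    refine mul_le_mul_of_nonneg_right ?_ (norm_nonneg _)
    rw [← mul_div_assoc, div_le_iff₀ (by linarith [boxConst_nonneg ℓ])]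
    nlinarith

/-- The class in `L²` of the box of a continuous function. -/
def clsL2 (ℓ : ℝ) (v : E3 → F) (hv : Continuous v) : Lp F 2 (boxMeasure ℓ) :=
  (memLp_of_continuous ℓ hv 2).toLp v

theorem coeFn_clsL2 {v : E3 → F} (hv : Continuous v) : clsL2 ℓ v hv =ᵐ[boxMeasure ℓ] v :=
  MemLp.coeFn_toLp _

theorem integrableOn_box {v : E3 → F} (hv : Continuous v) : IntegrableOn v (box ℓ) :=
  memLp_one_iff_integrable.1 (memLp_of_continuous ℓ hv 1)

theorem hasDerivAt_comp_line [NormedSpace ℝ F] {h : E3 → F} (hd : Differentiable ℝ h)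
    (x y z : E3) (s : ℝ) :
    HasDerivAt (fun s : ℝ => h (x + (y + s • z))) (fderiv ℝ h (x + (y + s • z)) z) s := by
  have h1 : HasDerivAt (fun s : ℝ => x + (y + s • z)) z s := by
    have := (((hasDerivAt_id s).smul_const z).const_add y).const_add x
    simpa only [one_smul] using! this
  exact (hd _).hasFDerivAt.comp_hasDerivAt s h1

theorem hasDerivAt_translate [NormedSpace ℝ F] {h : E3 → F} (hd : ContDiff ℝ 1 h) (y z : E3)
    {v v' : ℝ → Lp F 2 (boxMeasure ℓ)}
    (hv : ∀ s, v s =ᵐ[boxMeasure ℓ] fun x => h (x + (y + s • z)))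
    (hv' : ∀ s, v' s =ᵐ[boxMeasure ℓ] fun x => fderiv ℝ h (x + (y + s • z)) z) (t : ℝ) :
    HasDerivAt v (v' t) t := by
  refine hasDerivAt_curve isOpen_univ
    (fun s _ x => hasDerivAt_comp_line (hd.differentiable one_ne_zero) x y z s)
    (Continuous.continuousOn ?_) (fun s _ => hv s) (fun s _ => hv' s) (Set.mem_univ t)
  have := hd.continuous_fderiv one_ne_zero
  fun_prop

/-- The integral over the box of a partial derivative of a periodic function vanishes. -/
theorem setIntegral_fderiv_eq_zero (hℓ : 0 < ℓ) {h : E3 → ℝ} (hd : ContDiff ℝ 1 h)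
    (hp : IsPeriodic ℓ h) (z : E3) : ∫ x in box ℓ, fderiv ℝ h x z = 0 := by
  have hc := hd.continuous
  have hc' := hd.continuous_fderiv one_ne_zero
  have h1 := hasDerivAt_translate (ℓ := ℓ) hd 0 z
    (v := fun s => clsL2 ℓ (fun x => h (x + (0 + s • z))) (by fun_prop))
    (v' := fun s => clsL2 ℓ (fun x => fderiv ℝ h (x + (0 + s • z)) z) (by fun_prop))
    (fun s => coeFn_clsL2 _) (fun s => coeFn_clsL2 _) 0
  have h2 := (hasDerivAt_const (0 : ℝ) (clsL2 ℓ (fun _ => (1 : ℝ)) continuous_const)).inner ℝ h1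
  have h3 : ∀ (k : E3 → ℝ) (hk : Continuous k),
      inner ℝ (clsL2 ℓ (fun _ => (1 : ℝ)) continuous_const) (clsL2 ℓ k hk)
        = ∫ x in box ℓ, k x := by
    intro k hk
    rw [L2.inner_def]
    refine integral_congr_ae ?_
    filter_upwards [coeFn_clsL2 (ℓ := ℓ) hk,
      coeFn_clsL2 (ℓ := ℓ) (continuous_const (y := (1 : ℝ)))] with x h4 h5
    rw [h4, h5]; simp
  -- By translation invariance the integral of x ↦ h (x + s • z) does not depend on s, so its
  -- derivative, the integral of the partial derivative, is 0.
  simp only [h3, setIntegral_box_add hℓ hp, inner_zero_left, add_zero, zero_smul] at h2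
  exact (h2.unique (hasDerivAt_const _ _)).symm ▸ rfl

end Curves

/-! ### The Poincaré inequality -/

section Poincare

variable {ℓ : ℝ}

theorem inner_L2_eq {v w : L2 ℓ} {V W : E3 → E3} (hv : v =ᵐ[boxMeasure ℓ] V)
    (hw : w =ᵐ[boxMeasure ℓ] W) : inner ℝ v w = ∫ x in box ℓ, inner ℝ (V x) (W x) := by
  rw [L2.inner_def]
  refine integral_congr_ae ?_
  filter_upwards [hv, hw] with x h1 h2
  rw [h1, h2]

theorem SmoothField.coeFn_toL2 (φ : SmoothField ℓ) : φ.toL2 =ᵐ[boxMeasure ℓ] φ :=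
  MemLp.coeFn_toLp _

theorem SmoothField.continuous (φ : SmoothField ℓ) : Continuous φ := φ.smooth.continuous

theorem SmoothField.contDiff_one (φ : SmoothField ℓ) : ContDiff ℝ 1 φ :=
  φ.smooth.of_le (by exact_mod_cast le_top)

/-- The translate `x ↦ φ (x + y)` of a smooth periodic field. -/
def SmoothField.translate (φ : SmoothField ℓ) (y : E3) : SmoothField ℓ where
  toFun x := φ (x + y)
  smooth := φ.smooth.comp (contDiff_id.add contDiff_const)
  periodic j x := by
    change φ (x + ℓ • e j + y) = φ (x + y)
    rw [add_right_comm]; exact φ.periodic j _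

theorem SmoothField.translate_pderiv (φ : SmoothField ℓ) (y : E3) (i : Fin 3) (x : E3) :
    (φ.translate y).pderiv i x = φ.pderiv i (x + y) :=
  congrArg (fun A : E3 →L[ℝ] E3 => A (e i)) (fderiv_comp_add_right (𝕜 := ℝ) (f := φ.toFun) y)

theorem SmoothField.norm_translate (hℓ : 0 < ℓ) (φ : SmoothField ℓ) (y : E3) :
    ‖(φ.translate y).toL2‖ = ‖φ.toL2‖ := by
  have h : ‖(φ.translate y).toL2‖ ^ 2 = ‖φ.toL2‖ ^ 2 := by
    rw [← real_inner_self_eq_norm_sq, ← real_inner_self_eq_norm_sq,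
      inner_L2_eq (φ.translate y).coeFn_toL2 (φ.translate y).coeFn_toL2,
      inner_L2_eq φ.coeFn_toL2 φ.coeFn_toL2]
    exact setIntegral_box_add (h := fun x => inner ℝ (φ x) (φ x)) hℓ
      (fun j x => by simp only [φ.periodic j x]) y
  exact (sq_eq_sq₀ (norm_nonneg _) (norm_nonneg _)).1 h

/-- The s-derivative falls on the test field, and the weak gradient turns it into a pairing of g i
with a translate of φ, whose norm is that of φ. -/
theorem IsWeakGradient.inner_translate_sub_le (hℓ : 0 < ℓ) {v : L2 ℓ} {g : L2Grad ℓ}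
    (hg : IsWeakGradient v g) (φ : SmoothField ℓ) (y : E3) (i : Fin 3) (s : ℝ) :
    |inner ℝ v (φ.translate (y + s • e i)).toL2 - inner ℝ v (φ.translate y).toL2|
      ≤ ‖g‖ * ‖φ.toL2‖ * |s| := by
  have hd : ∀ s : ℝ, HasDerivAt (fun s : ℝ => inner ℝ v (φ.translate (y + s • e i)).toL2)
      (-inner ℝ (g i) (φ.translate (y + s • e i)).toL2) s := by
    intro s
    have h1 := hasDerivAt_translate (ℓ := ℓ) φ.contDiff_one y (e i)
      (v := fun s => (φ.translate (y + s • e i)).toL2)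
      (v' := fun s => ((φ.translate (y + s • e i)).pderiv i).toL2)
      (fun s => SmoothField.coeFn_toL2 _)
      (fun s => (SmoothField.coeFn_toL2 _).trans
        (Eventually.of_forall fun x => φ.translate_pderiv _ i x)) s
    have h2 := (hasDerivAt_const s v).inner ℝ h1
    rwa [inner_zero_left, add_zero, hg _ i] at h2
  have h := (convex_univ (𝕜 := ℝ) (E := ℝ)).norm_image_sub_le_of_norm_hasDerivWithin_le
    (C := ‖g‖ * ‖φ.toL2‖) (x := 0) (y := s) (fun q _ => (hd q).hasDerivWithinAt)
    (fun q _ => ?_) (Set.mem_univ _) (Set.mem_univ _)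
  · simpa using h
  · rw [norm_neg]
    refine (norm_inner_le_norm _ _).trans ?_
    rw [φ.norm_translate hℓ]
    exact mul_le_mul_of_nonneg_right (PiLp.norm_apply_le g i) (norm_nonneg _)

/-- The point y is reached from 0 by three moves along the axes, each shorter than ℓ; hence the
factor 3ℓ. -/
theorem IsWeakGradient.inner_translate_sub_le_of_mem_box (hℓ : 0 < ℓ) {v : L2 ℓ} {g : L2Grad ℓ}
    (hg : IsWeakGradient v g) (φ : SmoothField ℓ) {y : E3} (hy : y ∈ box ℓ) :
    |inner ℝ v (φ.translate y).toL2 - inner ℝ v φ.toL2| ≤ 3 * ℓ * (‖g‖ * ‖φ.toL2‖) := by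
  have h0 := hg.inner_translate_sub_le hℓ φ 0 0 (y 0)
  have h1 := hg.inner_translate_sub_le hℓ φ (0 + y 0 • e 0) 1 (y 1)
  have h2 := hg.inner_translate_sub_le hℓ φ (0 + y 0 • e 0 + y 1 • e 1) 2 (y 2)
  have hy3 : (0 + y 0 • e 0 + y 1 • e 1 + y 2 • e 2 : E3) = y := by
    ext i; fin_cases i <;> simp
  have h00 : φ.translate 0 = φ := by
    cases φ; simp [SmoothField.translate]
  rw [hy3] at h2
  rw [h00] at h0
  have hc : 0 ≤ ‖g‖ * ‖φ.toL2‖ := by positivity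
  have hb : ∀ i, ‖g‖ * ‖φ.toL2‖ * |y i| ≤ ‖g‖ * ‖φ.toL2‖ * ℓ := fun i =>
    mul_le_mul_of_nonneg_left (by rw [abs_of_pos (hy i).1]; exact (hy i).2.le) hc
  have e0 := abs_le.1 (h0.trans (hb 0))
  have e1 := abs_le.1 (h1.trans (hb 1))
  have e2 := abs_le.1 (h2.trans (hb 2))
  rw [abs_le]
  constructor <;> linarith [e0.1, e0.2, e1.1, e1.2, e2.1, e2.2]

theorem volume_box_pos (hℓ : 0 < ℓ) : 0 < volume (box ℓ) := by
  refine (isOpen_box ℓ).measure_pos _ ⟨WithLp.toLp 2 fun _ => ℓ / 2, fun i => ?_⟩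
  constructor <;> simp <;> linarith

theorem vol_pos (hℓ : 0 < ℓ) : 0 < vol ℓ :=
  ENNReal.toReal_pos (volume_box_pos hℓ).ne' (isBounded_box ℓ).measure_lt_top.ne

theorem integrable_coeFn (v : L2 ℓ) : Integrable v (boxMeasure ℓ) :=
  (Lp.memLp v).integrable (by norm_num)

theorem SmoothField.exists_bound (φ : SmoothField ℓ) : ∃ C, ∀ x ∈ box ℓ, ∀ y ∈ box ℓ,
    ‖φ (x + y)‖ ≤ C := by
  have hK := (isCompact_closure_box ℓ).prod (isCompact_closure_box ℓ)
  obtain ⟨C, hC⟩ := hK.exists_bound_of_continuousOn (f := fun z : E3 × E3 => φ (z.1 + z.2))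
    (φ.continuous.comp (continuous_fst.add continuous_snd)).continuousOn
  exact ⟨C, fun x hx y hy => hC (x, y) ⟨subset_closure hx, subset_closure hy⟩⟩

theorem integrable_inner_translate (v : L2 ℓ) (φ : SmoothField ℓ) :
    Integrable (fun z : E3 × E3 => inner ℝ (v z.2) (φ (z.2 + z.1)))
      ((boxMeasure ℓ).prod (boxMeasure ℓ)) := by
  obtain ⟨C, hC⟩ := φ.exists_bound
  have hvi := (integrable_coeFn v).norm.comp_snd (boxMeasure ℓ)
  refine (hvi.mul_const C).mono' ?_ ?_
  · refine AEStronglyMeasurable.inner ?_ ?_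
    · exact (integrable_coeFn v).aestronglyMeasurable.comp_snd
    · exact (φ.continuous.comp (continuous_snd.add continuous_fst)).aestronglyMeasurable
  · rw [Measure.prod_restrict]
    refine ae_restrict_of_forall_mem ((measurableSet_box ℓ).prod (measurableSet_box ℓ)) ?_
    rintro ⟨y, x⟩ ⟨hy, hx⟩
    exact (norm_inner_le_norm _ _).trans
      (mul_le_mul_of_nonneg_left (hC x hx y hy) (norm_nonneg _))

theorem inner_translate_eq (v : L2 ℓ) (φ : SmoothField ℓ) (y : E3) :
    inner ℝ v (φ.translate y).toL2 = ∫ x in box ℓ, inner ℝ (v x) (φ (x + y)) :=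
  inner_L2_eq EventuallyEq.rfl (φ.translate y).coeFn_toL2

/-- By Fubini the average over y replaces φ by its mean, a constant field, and v is orthogonal to
constants. -/
theorem integral_inner_translate (hℓ : 0 < ℓ) {v : L2 ℓ} (hv : MeanZero ℓ v) (φ : SmoothField ℓ) :
    ∫ y in box ℓ, inner ℝ v (φ.translate y).toL2 = 0 := by
  simp only [inner_translate_eq]
  rw [integral_integral_swap (integrable_inner_translate v φ)]
  have h2 : ∀ x, ∫ y in box ℓ, inner ℝ (v x) (φ (x + y))
      = inner ℝ (∫ y in box ℓ, φ y) (v x) := by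
    intro x
    have h3 : Continuous fun y => φ (x + y) := φ.continuous.comp (continuous_const_add x)
    rw [integral_inner (𝕜 := ℝ) (integrableOn_box h3) (v x), ← setIntegral_box_add hℓ φ.periodic x,
      real_inner_comm]
    simp only [add_comm]
  simp only [h2]
  rw [integral_inner (𝕜 := ℝ) (integrable_coeFn v) (∫ y in box ℓ, φ y), hv, inner_zero_right]

/-- Averaging the translation estimate over y in the box removes the translated term. This is the
Poincaré inequality in dual form. -/
theorem IsWeakGradient.inner_le (hℓ : 0 < ℓ) {v : L2 ℓ} {g : L2Grad ℓ}
    (hg : IsWeakGradient v g) (hv : MeanZero ℓ v) (φ : SmoothField ℓ) :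
    |inner ℝ v φ.toL2| ≤ 3 * ℓ * (‖g‖ * ‖φ.toL2‖) := by
  have hint : IntegrableOn (fun y => inner ℝ v (φ.translate y).toL2) (box ℓ) := by
    simp only [inner_translate_eq]
    exact (integrable_inner_translate v φ).integral_prod_left
  have h1 : ∫ y in box ℓ, (inner ℝ v (φ.translate y).toL2 - inner ℝ v φ.toL2)
      = -(vol ℓ * inner ℝ v φ.toL2) := by
    rw [integral_sub hint (integrableOn_box continuous_const),
      integral_inner_translate hℓ hv, setIntegral_const, zero_sub, smul_eq_mul, vol]
  have h2 := norm_setIntegral_le_of_norm_le_const (μ := volume) (isBounded_box ℓ).measure_lt_top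
    (f := fun y => inner ℝ v (φ.translate y).toL2 - inner ℝ v φ.toL2)
    (fun y hy => hg.inner_translate_sub_le_of_mem_box hℓ φ hy)
  rw [h1, norm_neg, norm_mul, Real.norm_of_nonneg (vol_pos hℓ).le, mul_comm] at h2
  exact le_of_mul_le_mul_right h2 (vol_pos hℓ)

/-- The point of the half-open box that is congruent to `x` modulo the period lattice. -/
def wrap (hℓ : 0 < ℓ) (x : E3) : E3 := WithLp.toLp 2 fun i => toIcoMod hℓ 0 (x i)

theorem wrap_eq (hℓ : 0 < ℓ) {x y : E3} (hy : y ∈ box ℓ) (n : Fin 3 → ℤ)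
    (h : ∀ i, x i = y i + n i * ℓ) : wrap hℓ x = y := by
  ext i
  refine (toIcoMod_eq_iff hℓ).2 ⟨⟨(hy i).1.le, by simpa using (hy i).2⟩, n i, ?_⟩
  rw [zsmul_eq_mul, h i]

theorem exists_margin (ℓ : ℝ) {K : Set E3} (hK : IsCompact K) (hKb : K ⊆ box ℓ) :
    ∃ r > 0, ∀ y ∈ K, ∀ i, r ≤ y i ∧ y i ≤ ℓ - r := by
  obtain ⟨r, hr, hrK⟩ := hK.exists_thickening_subset_open (isOpen_box ℓ) hKb
  have key : ∀ y ∈ K, ∀ i (c : ℝ), |c| < r → y i + c ∈ Set.Ioo 0 ℓ := by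
    intro y hy i c hc
    have : y + c • e i ∈ Metric.thickening r K := by
      rw [Metric.mem_thickening_iff]
      exact ⟨y, hy, by simpa [dist_eq_norm, norm_smul] using hc⟩
    simpa using hrK this i
  refine ⟨r, hr, fun y hy i => ⟨?_, ?_⟩⟩
  · by_contra! h
    have h0 := (hKb hy i).1
    have := (key y hy i (-y i) (by rwa [abs_neg, abs_of_pos h0])).1
    linarith
  · by_contra! h
    have h0 := (hKb hy i).2
    have := (key y hy i (ℓ - y i) (by rw [abs_of_pos (by linarith)]; linarith)).2
    linarith

/-- Periodizes a bump supported inside the box. Where `wrap` lands in the open box it is locally a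
translation by a fixed lattice vector; elsewhere x lies on a face of the lattice of boxes, near
which the periodized function vanishes. -/
theorem contDiff_comp_wrap (hℓ : 0 < ℓ) {ρ : E3 → ℝ} (hρ : ContDiff ℝ ∞ ρ)
    (hc : HasCompactSupport ρ) (hs : tsupport ρ ⊆ box ℓ) :
    ContDiff ℝ ∞ fun x => ρ (wrap hℓ x) := by
  obtain ⟨r, hr, hrK⟩ := exists_margin ℓ hc hs
  rw [contDiff_iff_contDiffAt]
  intro x
  have hx : ∀ i, x i = wrap hℓ x i + toIcoDiv hℓ 0 (x i) * ℓ := fun i => by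
    rw [← zsmul_eq_mul]; exact (toIcoMod_add_toIcoDiv_zsmul hℓ 0 (x i)).symm
  have hcont : ∀ (i : Fin 3) (t : ℝ), 0 < t → ∀ᶠ z : E3 in 𝓝 x, |z i - x i| < t := by
    intro i t ht
    have : Continuous fun z : E3 => |z i - x i| := by fun_prop
    exact this.tendsto' x 0 (by simp) |>.eventually (gt_mem_nhds ht)
  by_cases hb : wrap hℓ x ∈ box ℓ
  · have hsm : ContDiffAt ℝ ∞ (fun z => ρ (z - (x - wrap hℓ x))) x :=
      (hρ.comp (contDiff_id.sub contDiff_const)).contDiffAt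
    refine hsm.congr_of_eventuallyEq ?_
    have hcb : ContinuousAt (fun z => z - (x - wrap hℓ x)) x := by fun_prop
    have : ∀ᶠ z in 𝓝 x, z - (x - wrap hℓ x) ∈ box ℓ :=
      hcb.eventually ((isOpen_box ℓ).mem_nhds (by simpa using hb))
    filter_upwards [this] with z hz
    rw [wrap_eq hℓ hz (fun i => toIcoDiv hℓ 0 (x i))]
    intro i
    have := hx i
    simp only [PiLp.sub_apply]
    linarith
  · have hsm : ContDiffAt ℝ ∞ (fun _ : E3 => (0 : ℝ)) x := contDiffAt_const
    refine hsm.congr_of_eventuallyEq ?_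
    have hI : ∀ z : E3, ∀ i, wrap hℓ z i ∈ Set.Ico 0 ℓ := fun z i => by
      simpa [wrap] using toIcoMod_mem_Ico hℓ 0 (z i)
    obtain ⟨i, hi⟩ : ∃ i, wrap hℓ x i = 0 := by
      by_contra! h
      exact hb fun i => ⟨lt_of_le_of_ne (hI x i).1 (h i).symm, (hI x i).2⟩
    filter_upwards [hcont i r hr] with z hz
    by_contra hne
    have hm := hrK _ (subset_tsupport ρ hne) i
    have h1 : z i = wrap hℓ z i + toIcoDiv hℓ 0 (z i) * ℓ := by
      rw [← zsmul_eq_mul]; exact (toIcoMod_add_toIcoDiv_zsmul hℓ 0 (z i)).symm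
    have h2 := hx i
    rw [hi] at h2
    rw [h1, h2, abs_lt] at hz
    -- If the value at z were nonzero, the margin r would force the integer m - k strictly between
    -- -1 and 0.
    set m := toIcoDiv hℓ 0 (z i)
    set k := toIcoDiv hℓ 0 (x i)
    have h3 : (m - k : ℝ) * ℓ < 0 := by linarith
    have h4 : -1 * ℓ < (m - k : ℝ) * ℓ := by linarith
    have h5 : (m - k : ℝ) < 0 := by
      by_contra! h; exact absurd (mul_nonneg h hℓ.le) (by linarith)
    have h6 : (-1 : ℝ) < m - k := lt_of_mul_lt_mul_right h4 hℓ.le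
    have h7 : m - k < 0 := by exact_mod_cast h5
    have h8 : -1 < m - k := by exact_mod_cast h6
    omega

theorem wrap_add_period (hℓ : 0 < ℓ) (j : Fin 3) (x : E3) :
    wrap hℓ (x + ℓ • e j) = wrap hℓ x := by
  ext i
  simp only [wrap, PiLp.add_apply, PiLp.smul_apply, smul_eq_mul]
  by_cases h : i = j
  · subst h; simp
  · simp [h]

/-- Periodized bumps times constant vectors are admissible test fields, so the fundamental lemma of
the calculus of variations applies inside the box. -/
theorem eq_zero_of_inner_smoothField (hℓ : 0 < ℓ) {v : L2 ℓ}
    (hv : ∀ φ : SmoothField ℓ, inner ℝ v φ.toL2 = 0) : v = 0 := by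
  have hloc : LocallyIntegrableOn v (box ℓ) volume :=
    IntegrableOn.locallyIntegrableOn (integrable_coeFn v)
  have hz := (isOpen_box ℓ).ae_eq_zero_of_integral_contDiff_smul_eq_zero hloc ?_
  · refine Lp.ext ?_
    filter_upwards [(ae_restrict_iff' (measurableSet_box ℓ)).2 hz,
      Lp.coeFn_zero E3 2 (boxMeasure ℓ)] with x h1 h2
    rw [h1, h2]; rfl
  intro ρ hρ hc hs
  have hint : Integrable (fun x => ρ x • v x) (boxMeasure ℓ) := by
    obtain ⟨C, hC⟩ := hc.exists_bound_of_continuous hρ.continuous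
    exact (integrable_coeFn v).bdd_smul C hρ.continuous.aestronglyMeasurable
      (Eventually.of_forall hC)
  have h1 : ∫ x, ρ x • v x = ∫ x in box ℓ, ρ x • v x := by
    refine (setIntegral_eq_integral_of_forall_compl_eq_zero fun x hx => ?_).symm
    rw [image_eq_zero_of_notMem_tsupport fun h => hx (hs h), zero_smul]
  rw [h1]
  refine ext_inner_right ℝ fun c => ?_
  let φ : SmoothField ℓ :=
    { toFun := fun x => ρ (wrap hℓ x) • c
      smooth := (contDiff_comp_wrap hℓ hρ hc hs).smul contDiff_const
      periodic := fun j x => by simp only [wrap_add_period] }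
  have h2 := hv φ
  rw [inner_L2_eq EventuallyEq.rfl φ.coeFn_toL2] at h2
  rw [inner_zero_left, real_inner_comm, ← integral_inner hint, ← h2]
  refine setIntegral_congr_fun (measurableSet_box ℓ) fun x hx => ?_
  have h3 : wrap hℓ x = x := wrap_eq hℓ hx 0 (by simp)
  simp only [φ, h3, real_inner_smul_left, real_inner_smul_right, real_inner_comm]

/-- The subspace of `L²` that consists of the smooth periodic fields. -/
def smoothL2 (ℓ : ℝ) : Submodule ℝ (L2 ℓ) where
  carrier := Set.range SmoothField.toL2
  zero_mem' := ⟨⟨fun _ => 0, contDiff_const, fun _ _ => rfl⟩, MemLp.toLp_zero _⟩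
  add_mem' := by
    rintro _ _ ⟨φ, rfl⟩ ⟨ψ, rfl⟩
    refine ⟨⟨fun x => φ x + ψ x, φ.smooth.add ψ.smooth, fun j x => ?_⟩, MemLp.toLp_add _ _⟩
    simp only [φ.periodic j x, ψ.periodic j x]
  smul_mem' := by
    rintro c _ ⟨φ, rfl⟩
    refine ⟨⟨fun x => c • φ x, φ.smooth.const_smul c, fun j x => ?_⟩,
      MemLp.toLp_const_smul c (memLp_of_continuous ℓ φ.continuous 2)⟩
    simp only [φ.periodic j x]

theorem dense_smoothL2 (hℓ : 0 < ℓ) : Dense (smoothL2 ℓ : Set (L2 ℓ)) := by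
  rw [Submodule.dense_iff_topologicalClosure_eq_top,
    Submodule.topologicalClosure_eq_top_iff, Submodule.eq_bot_iff]
  intro v hv
  exact eq_zero_of_inner_smoothField hℓ fun φ =>
    (Submodule.mem_orthogonal' _ _).1 hv _ ⟨φ, rfl⟩

/-- The **Poincaré inequality** for weakly differentiable periodic fields of mean zero. -/
theorem IsWeakGradient.norm_le (hℓ : 0 < ℓ) {v : L2 ℓ} {g : L2Grad ℓ}
    (hg : IsWeakGradient v g) (hv : MeanZero ℓ v) : ‖v‖ ≤ 3 * ℓ * ‖g‖ := by
  have hcl : IsClosed {a : L2 ℓ | |inner ℝ v a| ≤ 3 * ℓ * (‖g‖ * ‖a‖)} :=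
    isClosed_le (by fun_prop) (by fun_prop)
  -- The dual estimate extends from smooth fields to all of L² by density, in particular to v
  -- itself.
  have h : |inner ℝ v v| ≤ 3 * ℓ * (‖g‖ * ‖v‖) := by
    have hsub : (smoothL2 ℓ : Set (L2 ℓ)) ⊆ {a | |inner ℝ v a| ≤ 3 * ℓ * (‖g‖ * ‖a‖)} := by
      rintro _ ⟨φ, rfl⟩
      exact hg.inner_le hℓ hv φ
    have := hcl.closure_subset_iff.2 hsub
    rw [(dense_smoothL2 hℓ).closure_eq] at this
    exact this (Set.mem_univ v)
  rw [real_inner_self_eq_norm_sq, abs_of_nonneg (sq_nonneg _)] at h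
  rcases (norm_nonneg v).eq_or_lt' with h0 | h0
  · rw [h0]; positivity
  · nlinarith

end Poincare

/-! ### Integration by parts -/

section Parts

variable {ℓ : ℝ} {F G : Type*}

theorem IsPeriodic.fderiv [NormedAddCommGroup F] [NormedSpace ℝ F] {h : E3 → F}
    (hp : IsPeriodic ℓ h) : IsPeriodic ℓ (fderiv ℝ h) := by
  intro j x
  have h1 : (fun y => h (y + ℓ • e j)) = h := funext fun y => hp j y
  have h2 := fderiv_comp_add_right (𝕜 := ℝ) (f := h) (x := x) (ℓ • e j)
  rw [h1] at h2
  exact h2.symm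

theorem setIntegral_inner_fderiv (hℓ : 0 < ℓ) {a b : E3 → E3} (ha : ContDiff ℝ 1 a)
    (hb : ContDiff ℝ 1 b) (hpa : IsPeriodic ℓ a) (hpb : IsPeriodic ℓ b) (z : E3) :
    ∫ x in box ℓ, inner ℝ (a x) (fderiv ℝ b x z)
      = -∫ x in box ℓ, inner ℝ (fderiv ℝ a x z) (b x) := by
  have hca := ha.continuous
  have hcb := hb.continuous
  have hca' := ha.continuous_fderiv one_ne_zero
  have hcb' := hb.continuous_fderiv one_ne_zero
  have h0 := setIntegral_fderiv_eq_zero hℓ (ha.inner ℝ hb)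
    (fun j x => by simp only [hpa j x, hpb j x]) z
  have h1 : ∀ x, fderiv ℝ (fun x => inner ℝ (a x) (b x)) x z
      = inner ℝ (a x) (fderiv ℝ b x z) + inner ℝ (fderiv ℝ a x z) (b x) := fun x =>
    fderiv_inner_apply ℝ (ha.differentiable one_ne_zero x) (hb.differentiable one_ne_zero x) z
  simp only [h1] at h0
  rw [integral_add (integrableOn_box (by fun_prop)) (integrableOn_box (by fun_prop))] at h0
  linarith

theorem isWeakGradient_of_contDiff (hℓ : 0 < ℓ) {v : L2 ℓ} {g : L2Grad ℓ} {w : E3 → E3}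
    (hw : ContDiff ℝ 1 w) (hp : IsPeriodic ℓ w) (hv : v =ᵐ[boxMeasure ℓ] w)
    (hg : ∀ i, g i =ᵐ[boxMeasure ℓ] fun x => fderiv ℝ w x (e i)) : IsWeakGradient v g := by
  intro φ i
  rw [inner_L2_eq hv (φ.pderiv i).coeFn_toL2, inner_L2_eq (hg i) φ.coeFn_toL2]
  exact setIntegral_inner_fderiv hℓ hw φ.contDiff_one hp φ.periodic (e i)

theorem SmoothField.isWeakGradient (hℓ : 0 < ℓ) (φ : SmoothField ℓ) :
    IsWeakGradient φ.toL2 φ.grad :=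
  isWeakGradient_of_contDiff hℓ φ.contDiff_one φ.periodic φ.coeFn_toL2
    fun i => (φ.pderiv i).coeFn_toL2

theorem meanZero_congr {v : L2 ℓ} {w : E3 → E3} (h : v =ᵐ[boxMeasure ℓ] w) (hw : MeanZero ℓ w) :
    MeanZero ℓ v :=
  (integral_congr_ae h).trans hw

end Parts

/-! ### The fluctuation operator -/

section Fluctuation

variable {ℓ δ : ℝ} {N : ℕ}

/-- Symmetric splitting of the relaxation term; it permits Young's inequality between B u and B f.
-/
theorem inner_fluctuation (hδ : 0 < δ) (v w : L2 ℓ) :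
    inner ℝ (fluctuation ℓ δ N v) w
      = δ ^ (2 * N + 2) * inner ℝ (opB ℓ δ N v) (opB ℓ δ N w) := by
  obtain ⟨hp, hsq⟩ := opB_spec ℓ δ N
  have h1 : fluctuation ℓ δ N v = δ ^ (2 * N + 2) • opB ℓ δ N (opB ℓ δ N v) := by
    have := congrArg (fun A : L2 ℓ →L[ℝ] L2 ℓ => δ ^ (2 * N + 2) • A v) hsq
    simp only [mul_apply_eq_comp, smul_apply] at this
    rw [this, smul_smul, mul_inv_cancel₀ (by positivity), one_smul]
  rw [h1, real_inner_smul_left, hp.isSelfAdjoint.isSymmetric.apply_clm]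

theorem inner_fluctuation_self (hδ : 0 < δ) (v : L2 ℓ) :
    inner ℝ (fluctuation ℓ δ N v) v = δ ^ (2 * N + 2) * ‖opB ℓ δ N v‖ ^ 2 := by
  rw [inner_fluctuation hδ, real_inner_self_eq_norm_sq]

theorem inner_fluctuation_self_nonneg (hδ : 0 < δ) (v : L2 ℓ) :
    0 ≤ inner ℝ (fluctuation ℓ δ N v) v := by
  rw [inner_fluctuation_self hδ]; positivity

/-- By self-adjointness ‖Aⁿ⁺¹x‖² = (Aⁿx, Aⁿ⁺²x), so the exponent can be lowered one step at a time.
-/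
theorem eq_zero_of_pow_eq_zero {H : Type*} [NormedAddCommGroup H] [InnerProductSpace ℝ H]
    [CompleteSpace H] {A : H →L[ℝ] H} (hA : IsSelfAdjoint A) {x : H} :
    ∀ n : ℕ, (A ^ (n + 1)) x = 0 → A x = 0
  | 0, h => by simpa using h
  | n + 1, h => by
    refine eq_zero_of_pow_eq_zero hA n ?_
    have h1 : inner ℝ ((A ^ (n + 1)) x) ((A ^ (n + 1)) x) = (0 : ℝ) := by
      have h2 : (A ^ (n + 1)) x = A ((A ^ n) x) := by rw [pow_succ']; rfl
      have h3 : A ((A ^ (n + 1)) x) = 0 := by rw [pow_succ'] at h; exact h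
      conv_lhs => rw [h2]
      rw [hA.isSymmetric.apply_clm, ← h2, h3, inner_zero_right]
    exact inner_self_eq_zero.1 h1

/-- If Bv = 0 then (I - G)^{N+1} v = 0, hence Gv = v. Testing the filter equation with v leaves
δ²‖∇v‖² = 0, and the Poincaré inequality finishes. -/
theorem eq_zero_of_opB_eq_zero (hℓ : 0 < ℓ) (hδ : 0 < δ) {v : L2 ℓ} (hv : MeanZero ℓ v)
    (h : opB ℓ δ N v = 0) : v = 0 := by
  have h1 : fluctuation ℓ δ N v = 0 := by
    rw [← inner_self_eq_zero (𝕜 := ℝ), inner_fluctuation hδ, h, inner_zero_left, mul_zero]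
  rw [fluctuation_eq_pow] at h1
  have h2 := eq_zero_of_pow_eq_zero
    ((IsSelfAdjoint.one _).sub (isSelfAdjoint_diffFilter ℓ δ)) N h1
  have h3 : v = diffFilter ℓ δ v := sub_eq_zero.1 h2
  obtain ⟨g, hg, hw⟩ := (diffFilter_spec hδ.ne' v v).1 h3
  have h4 := hw v g hg
  have h5 : δ ^ 2 * ‖g‖ ^ 2 = 0 := by
    rw [← real_inner_self_eq_norm_sq]; linarith
  have h6 : ‖g‖ = 0 := by
    rcases mul_eq_zero.1 h5 with h7 | h7
    · exact absurd h7 (by positivity)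
    · exact pow_eq_zero_iff two_ne_zero |>.1 h7
  have h8 := hg.norm_le hℓ hv
  rw [h6, mul_zero] at h8
  exact norm_le_zero_iff.1 h8

end Fluctuation

/-! ### The scales of the body force -/

section Scales

variable {ℓ δ : ℝ} {N : ℕ} {f : SmoothField ℓ}

theorem timeAvg_const (c : ℝ) : timeAvg (fun _ => c) = c := by
  have h : avg (fun _ => c) =ᶠ[atTop] fun _ => c := by
    filter_upwards [eventually_ne_atTop 0] with T hT
    rw [avg, intervalIntegral.integral_const, sub_zero, smul_eq_mul, ← mul_assoc,
      one_div_mul_cancel hT, one_mul]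
  rw [timeAvg, limsup_congr h, limsup_const]

/-- The point where f is nonzero may lie outside the open box; a translation moves it to the centre
without changing the L² norm. -/
theorem SmoothField.toL2_ne_zero (hℓ : 0 < ℓ) (hf0 : ∃ x, f x ≠ 0) : f.toL2 ≠ 0 := by
  obtain ⟨x, hx⟩ := hf0
  intro h
  set c : E3 := WithLp.toLp 2 fun _ => ℓ / 2
  have hc : c ∈ box ℓ := fun i => by constructor <;> simp [c] <;> linarith
  have h1 : (f.translate (x - c)).toL2 = 0 := by
    rw [← norm_eq_zero, f.norm_translate hℓ, h, norm_zero]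
  have h2 : ∀ᵐ z ∂boxMeasure ℓ, f.translate (x - c) z = 0 := by
    filter_upwards [(f.translate (x - c)).coeFn_toL2, Lp.coeFn_zero E3 2 (boxMeasure ℓ)]
      with z h3 h4
    rw [← h3, h1, h4]; rfl
  have h3 := Measure.eqOn_open_of_ae_eq (g := fun _ => (0 : E3)) h2 (isOpen_box ℓ)
    (f.translate (x - c)).continuous.continuousOn continuousOn_const
  have h4 : f (c + (x - c)) = 0 := h3 hc
  rw [add_sub_cancel] at h4
  exact hx h4

theorem SmoothField.continuous_gradNorm (f : SmoothField ℓ) :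
    Continuous fun x => √(∑ i, ‖f.pderiv i x‖ ^ 2) := by
  have := fun i => (f.pderiv i).continuous
  fun_prop

theorem gradNorm_le_gradSup (f : SmoothField ℓ) :
    ∀ᵐ x ∂boxMeasure ℓ, √(∑ i, ‖f.pderiv i x‖ ^ 2) ≤ gradSup f := by
  have hm := memLp_of_continuous ℓ f.continuous_gradNorm ⊤
  have h := ae_le_eLpNormEssSup (f := fun x => √(∑ i, ‖f.pderiv i x‖ ^ 2)) (μ := boxMeasure ℓ)
  filter_upwards [h] with x hx
  rw [← eLpNorm_exponent_top] at hx
  have := ENNReal.toReal_mono hm.eLpNorm_ne_top hx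
  rw [toReal_enorm, Real.norm_of_nonneg (Real.sqrt_nonneg _)] at this
  exact this

theorem gradSup_nonneg (f : SmoothField ℓ) : 0 ≤ gradSup f := ENNReal.toReal_nonneg

theorem SmoothField.grad_ne_zero (hℓ : 0 < ℓ) (hf : f.IsSolenoidal) (hf0 : ∃ x, f x ≠ 0) :
    f.grad ≠ 0 := by
  intro h
  have h1 := (f.isWeakGradient hℓ).norm_le hℓ (meanZero_congr f.coeFn_toL2 hf.2)
  rw [h, norm_zero, mul_zero] at h1
  exact toL2_ne_zero hℓ hf0 (norm_le_zero_iff.1 h1)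

theorem gradSup_pos (hℓ : 0 < ℓ) (hf : f.IsSolenoidal) (hf0 : ∃ x, f x ≠ 0) : 0 < gradSup f := by
  refine (gradSup_nonneg f).lt_of_ne' fun h => SmoothField.grad_ne_zero hℓ hf hf0 ?_
  ext i : 1
  refine Lp.ext ?_
  filter_upwards [gradNorm_le_gradSup f, (f.pderiv i).coeFn_toL2,
    Lp.coeFn_zero E3 2 (boxMeasure ℓ)] with x h1 h2 h3
  rw [h] at h1
  have h4 : ‖f.pderiv i x‖ ^ 2 ≤ 0 :=
    (Finset.single_le_sum (f := fun i => ‖f.pderiv i x‖ ^ 2) (fun _ _ => sq_nonneg _)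
      (Finset.mem_univ i)).trans (Real.sqrt_eq_zero'.1 (le_antisymm h1 (Real.sqrt_nonneg _)))
  have h5 : f.pderiv i x = 0 := by
    rw [← norm_eq_zero]; exact pow_eq_zero_iff two_ne_zero |>.1 (le_antisymm h4 (sq_nonneg _))
  change (f.pderiv i).toL2 x = (0 : L2 ℓ) x
  rw [h2, h3, h5]; rfl

theorem forceScale_eq (f : SmoothField ℓ) : forceScale f = √(1 / vol ℓ * ‖f.toL2‖ ^ 2) := by
  unfold forceScale meanSquare
  rw [timeAvg_const]

theorem forceScale_sq (hℓ : 0 < ℓ) (f : SmoothField ℓ) :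
    forceScale f ^ 2 = 1 / vol ℓ * ‖f.toL2‖ ^ 2 := by
  have := vol_pos hℓ
  rw [forceScale_eq, Real.sq_sqrt (by positivity)]

theorem forceScale_pos (hℓ : 0 < ℓ) (hf0 : ∃ x, f x ≠ 0) : 0 < forceScale f := by
  have h1 := vol_pos hℓ
  have h2 := norm_pos_iff.2 (SmoothField.toL2_ne_zero hℓ hf0)
  rw [forceScale_eq]; positivity

theorem lengthScale_pos (hℓ : 0 < ℓ) (hδ : 0 < δ) (hf : f.IsSolenoidal) (hf0 : ∃ x, f x ≠ 0) :
    0 < lengthScale δ N f := by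
  have hV := vol_pos hℓ
  have hF := forceScale_pos hℓ hf0
  have hg := norm_pos_iff.2 (SmoothField.grad_ne_zero hℓ hf hf0)
  have hs := gradSup_pos hℓ hf hf0
  have hB : 0 < ‖opB ℓ δ N f.toL2‖ := norm_pos_iff.2 fun h =>
    SmoothField.toL2_ne_zero hℓ hf0
      (eq_zero_of_opB_eq_zero hℓ hδ (meanZero_congr f.coeFn_toL2 hf.2) h)
  unfold lengthScale meanSquare
  simp only [timeAvg_const]
  refine lt_min (lt_min ?_ ?_) (lt_min ?_ ?_) <;> positivity

theorem lengthScale_grad_le (hℓ : 0 < ℓ) (hδ : 0 < δ) (hf : f.IsSolenoidal)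
    (hf0 : ∃ x, f x ≠ 0) :
    lengthScale δ N f ^ 2 * (1 / vol ℓ * ‖f.grad‖ ^ 2) ≤ forceScale f ^ 2 := by
  have hV := vol_pos hℓ
  have hg := norm_pos_iff.2 (SmoothField.grad_ne_zero hℓ hf hf0)
  have h : lengthScale δ N f ≤ forceScale f / √(1 / vol ℓ * ‖f.grad‖ ^ 2) := by
    unfold lengthScale
    rw [timeAvg_const]
    exact (min_le_left _ _).trans (min_le_right _ _)
  rw [le_div_iff₀ (by positivity)] at h
  have h0 := lengthScale_pos (N := N) hℓ hδ hf hf0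
  have h2 := pow_le_pow_left₀ (by positivity) h 2
  rwa [mul_pow, Real.sq_sqrt (by positivity)] at h2

theorem lengthScale_gradSup_le (hℓ : 0 < ℓ) (hf : f.IsSolenoidal) (hf0 : ∃ x, f x ≠ 0) :
    lengthScale δ N f * gradSup f ≤ forceScale f := by
  rw [← le_div_iff₀ (gradSup_pos hℓ hf hf0)]
  exact (min_le_right _ _ : lengthScale δ N f ≤ _).trans (min_le_left _ _)

theorem lengthScale_opB_le (hℓ : 0 < ℓ) (hδ : 0 < δ) (hf : f.IsSolenoidal)
    (hf0 : ∃ x, f x ≠ 0) :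
    lengthScale δ N f ^ (2 * N + 2) * (1 / vol ℓ * ‖opB ℓ δ N f.toL2‖ ^ 2)
      ≤ forceScale f ^ 2 := by
  have hV := vol_pos hℓ
  have hF := forceScale_pos hℓ hf0
  have hB : 0 < ‖opB ℓ δ N f.toL2‖ := norm_pos_iff.2 fun h =>
    SmoothField.toL2_ne_zero hℓ hf0
      (eq_zero_of_opB_eq_zero hℓ hδ (meanZero_congr f.coeFn_toL2 hf.2) h)
  set b := 1 / vol ℓ * ‖opB ℓ δ N f.toL2‖ ^ 2 with hb
  have hb0 : 0 < b := by positivity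
  have h : lengthScale δ N f ≤
      forceScale f ^ (1 / (N + 1) : ℝ) / b ^ (1 / (2 * N + 2) : ℝ) := by
    unfold lengthScale meanSquare
    rw [timeAvg_const (_ * ‖opB ℓ δ N f.toL2‖ ^ 2), ← hb]
    exact (min_le_right _ _).trans (min_le_right _ _)
  rw [le_div_iff₀ (by positivity)] at h
  have h0 := lengthScale_pos (N := N) hℓ hδ hf hf0
  -- The power 2N+2 clears both fractional exponents: it turns F^{1/(N+1)} into F².
  have h2 := pow_le_pow_left₀ (by positivity) h (2 * N + 2)
  have h3 : (b ^ (1 / (2 * N + 2) : ℝ)) ^ (2 * N + 2) = b := by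
    rw [← Real.rpow_natCast, ← Real.rpow_mul hb0.le]
    push_cast
    rw [one_div_mul_cancel (by positivity), Real.rpow_one]
  have h4 : (forceScale f ^ (1 / (N + 1) : ℝ)) ^ (2 * N + 2) = forceScale f ^ 2 := by
    rw [← Real.rpow_natCast, ← Real.rpow_mul hF.le, ← Real.rpow_natCast]
    congr 1
    push_cast
    field_simp
  rwa [mul_pow, h3, h4] at h2

end Scales

/-! ### Long time averages -/

section Averages

variable {a d : ℝ → ℝ}

theorem HasTimeAvg.eventually_le (ha : HasTimeAvg a) {ε : ℝ} (hε : 0 < ε) :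
    ∀ᶠ T in atTop, avg a T ≤ timeAvg a + ε := by
  have h : timeAvg a < timeAvg a + ε := by linarith
  exact (eventually_lt_of_limsup_lt h ha.2).mono fun _ h => h.le

theorem avg_nonneg (ha0 : ∀ t, 0 ≤ a t) {T : ℝ} (hT : 0 < T) : 0 ≤ avg a T :=
  mul_nonneg (by positivity) (intervalIntegral.integral_nonneg hT.le fun t _ => ha0 t)

theorem timeAvg_le (ha0 : ∀ t, 0 ≤ a t) {c : ℝ}
    (h : ∀ ε > 0, ∀ᶠ T in atTop, avg a T ≤ c + ε) : timeAvg a ≤ c := by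
  refine le_of_forall_pos_le_add fun ε hε => limsup_le_of_le ?_ (h ε hε)
  -- A real `limsup` is meaningful only for functions bounded appropriately; nonnegativity of the
  -- averages supplies the required lower bound.
  refine IsCoboundedUnder.of_frequently_ge (a := 0) (Eventually.frequently ?_)
  filter_upwards [eventually_gt_atTop 0] with T hT using avg_nonneg ha0 hT

theorem HasTimeAvg.timeAvg_nonneg (ha : HasTimeAvg a) (ha0 : ∀ t, 0 ≤ a t) : 0 ≤ timeAvg a := by
  refine le_of_forall_pos_le_add fun ε hε => ?_
  obtain ⟨T, h1, h2⟩ := ((ha.eventually_le hε).and (eventually_gt_atTop 0)).exists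
  exact (avg_nonneg ha0 h2).trans h1

theorem hasTimeAvg_of_integral_le (hi : ∀ T > 0, IntervalIntegrable a volume 0 T) {k c : ℝ}
    (h : ∀ T > 0, ∫ t in (0 : ℝ)..T, a t ≤ k + c * T) : HasTimeAvg a := by
  refine ⟨hi, isBoundedUnder_of_eventually_le (a := |k| + c) ?_⟩
  filter_upwards [eventually_ge_atTop 1] with T hT
  have hT0 : 0 < T := by linarith
  have h1 := h T hT0
  rw [avg, one_div, inv_mul_le_iff₀ hT0]
  nlinarith [le_abs_self k, abs_nonneg k]

theorem eventually_div_le (k : ℝ) {ε : ℝ} (hε : 0 < ε) : ∀ᶠ T : ℝ in atTop, k / T ≤ ε :=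
  ((tendsto_const_nhds (x := k)).div_atTop tendsto_id).eventually (ge_mem_nhds hε)

theorem timeAvg_le_of_integral_le (ha : HasTimeAvg a) (hd0 : ∀ t, 0 ≤ d t)
    {k r q : ℝ} (hq : 0 ≤ q)
    (h : ∀ T > 0, ∫ t in (0 : ℝ)..T, d t ≤ k + r * T + q * ∫ t in (0 : ℝ)..T, a t) :
    timeAvg d ≤ r + q * timeAvg a := by
  refine timeAvg_le hd0 fun ε hε => ?_
  have hη : 0 < ε / (1 + q) := by positivity
  filter_upwards [ha.eventually_le hη, eventually_div_le k hη, eventually_gt_atTop 0]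
    with T h1 h2 hT
  have h3 : avg d T ≤ k / T + r + q * avg a T := by
    have := mul_le_mul_of_nonneg_left (h T hT) (one_div_pos.2 hT).le
    refine this.trans_eq ?_
    rw [avg]; field_simp
  have h4 : ε / (1 + q) + q * (ε / (1 + q)) = ε := by field_simp
  nlinarith [mul_le_mul_of_nonneg_left h1 hq]

/-- The left side is constant after division by T, so a single large T at which both averages are
near their upper limits suffices. -/
theorem le_of_le_integral (ha : HasTimeAvg a) (hd : HasTimeAvg d) {c k r p q : ℝ} (hp : 0 ≤ p) (hq : 0 ≤ q)
    (h : ∀ T > 0, c * T ≤ k + r * T + p * (∫ t in (0 : ℝ)..T, d t)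
      + q * ∫ t in (0 : ℝ)..T, a t) :
    c ≤ r + p * timeAvg d + q * timeAvg a := by
  refine le_of_forall_pos_le_add fun ε hε => ?_
  have hη : 0 < ε / (1 + p + q) := by positivity
  obtain ⟨T, ⟨h1, h1'⟩, h2, hT⟩ := (((ha.eventually_le hη).and (hd.eventually_le hη)).and
    ((eventually_div_le k hη).and (eventually_gt_atTop 0))).exists
  have h3 : c ≤ k / T + r + p * avg d T + q * avg a T := by
    have := mul_le_mul_of_nonneg_left (h T hT) (one_div_pos.2 hT).le
    rw [show 1 / T * (c * T) = c by field_simp] at this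
    refine this.trans_eq ?_
    rw [avg, avg]; field_simp
  have h4 : ε / (1 + p + q) + p * (ε / (1 + p + q)) + q * (ε / (1 + p + q)) = ε := by field_simp
  nlinarith [mul_le_mul_of_nonneg_left h1 hq, mul_le_mul_of_nonneg_left h1' hp]

/-- Upgrades energy estimates valid for almost every T, once a T has been dropped, to every T > 0.
-/
theorem le_of_ae_le_of_continuousOn (x y : ℝ → ℝ) (hx : ContinuousOn x (Set.Ioi 0))
    (hy : ContinuousOn y (Set.Ioi 0)) (h : ∀ᵐ t ∂volume.restrict (Set.Ioi 0), x t ≤ y t)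
    {t : ℝ} (ht : 0 < t) : x t ≤ y t := by
  have h1 := Measure.eqOn_open_of_ae_eq (f := fun t => max (x t) (y t)) (g := y)
    (h.mono fun t ht => max_eq_right ht) isOpen_Ioi (hx.sup hy) hy
  exact (le_max_left _ _).trans_eq (h1 ht)

theorem continuousOn_primitive (hi : ∀ T > 0, IntervalIntegrable a volume 0 T) :
    ContinuousOn (fun T => ∫ t in (0 : ℝ)..T, a t) (Set.Ioi 0) := by
  intro T hT
  have hT1 : (0 : ℝ) < T + 1 := by linarith [Set.mem_Ioi.1 hT]
  have h := intervalIntegral.continuousOn_primitive_interval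
    ((intervalIntegrable_iff' (by simp)).1 (hi (T + 1) hT1))
  rw [Set.uIcc_of_le hT1.le] at h
  exact (h.continuousAt (Icc_mem_nhds hT (by linarith))).continuousWithinAt

/-- Bounds for long time averages that follow from an energy inequality, a Poincaré inequality
and the weak form of the equation tested against the force. -/
theorem timeAvg_bounds {F K₀ P S M : ℝ} (ha0 : ∀ t, 0 ≤ a t) (hd0 : ∀ t, 0 ≤ d t)
    (hai : ∀ T > 0, IntervalIntegrable a volume 0 T)
    (hdi : ∀ T > 0, IntervalIntegrable d volume 0 T) (hP : 0 < P) (hS : 0 ≤ S)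
    (hPoincare : ∀ᵐ t ∂volume.restrict (Set.Ioi 0), a t ≤ P * d t)
    (henergy : ∀ α > 0, ∀ᵐ T ∂volume.restrict (Set.Ioi 0),
      a T / 2 + ∫ t in (0 : ℝ)..T, d t ≤
        K₀ + α * F ^ 2 / 2 * T + 1 / (2 * α) * ∫ t in (0 : ℝ)..T, a t)
    (hweak : ∀ β > 0, ∀ η > 0, ∃ K, ∀ᵐ T ∂volume.restrict (Set.Ioi 0),
      F ^ 2 * T ≤ η * a T + K + β / 2 * (∫ t in (0 : ℝ)..T, d t)
        + S * (∫ t in (0 : ℝ)..T, a t) + M / (2 * β) * T) :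
    HasTimeAvg a ∧ HasTimeAvg d ∧
      (∀ α > 0, timeAvg d ≤ α * F ^ 2 / 2 + 1 / (2 * α) * timeAvg a) ∧
      (∀ β > 0, F ^ 2 ≤ M / (2 * β) + β / 2 * timeAvg d + S * timeAvg a) := by
  have hca := continuousOn_primitive hai
  have hcd := continuousOn_primitive hdi
  have hPint : ∀ T > 0, ∫ t in (0 : ℝ)..T, a t ≤ P * ∫ t in (0 : ℝ)..T, d t := by
    intro T hT
    rw [← intervalIntegral.integral_const_mul]
    refine intervalIntegral.integral_mono_ae_restrict hT.le (hai T hT) ((hdi T hT).const_mul P) ?_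
    rw [← Measure.restrict_congr_set (Ioc_ae_eq_Icc (a := (0 : ℝ)) (b := T))]
    exact ae_restrict_of_ae_restrict_of_subset Set.Ioc_subset_Ioi_self hPoincare
  have hae : ∀ᵐ T ∂volume.restrict (Set.Ioi 0),
      a T + ∫ t in (0 : ℝ)..T, d t ≤ 2 * K₀ + P * F ^ 2 * T := by
    -- The choice α = P makes the last term of the energy inequality at most half the integral of d,
    -- which the left side absorbs.
    filter_upwards [henergy P hP, ae_restrict_mem measurableSet_Ioi] with T h1 hT
    have h2 := mul_le_mul_of_nonneg_left (hPint T hT) (by positivity : 0 ≤ 1 / (2 * P))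
    have h3 : ∀ z : ℝ, 1 / (2 * P) * (P * z) = z / 2 := fun z => by field_simp
    rw [h3] at h2
    linarith
  have hdle : ∀ T > 0, ∫ t in (0 : ℝ)..T, d t ≤ 2 * K₀ + P * F ^ 2 * T := by
    intro T hT
    refine le_of_ae_le_of_continuousOn _ (fun T => 2 * K₀ + P * F ^ 2 * T) hcd (by fun_prop) ?_ hT
    exact hae.mono fun t ht => by linarith [ha0 t]
  have hd := hasTimeAvg_of_integral_le hdi hdle
  have ha : HasTimeAvg a := hasTimeAvg_of_integral_le hai (k := P * (2 * K₀))
    (c := P * (P * F ^ 2)) fun T hT =>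
      ((hPint T hT).trans (mul_le_mul_of_nonneg_left (hdle T hT) hP.le)).trans_eq (by ring)
  refine ⟨ha, hd, fun α hα => ?_, fun β hβ => ?_⟩
  · refine timeAvg_le_of_integral_le (k := K₀) ha hd0 (by positivity) fun T hT => ?_
    refine le_of_ae_le_of_continuousOn _
      (fun T => K₀ + α * F ^ 2 / 2 * T + 1 / (2 * α) * ∫ t in (0 : ℝ)..T, a t) hcd ?_ ?_ hT
    · fun_prop
    · exact (henergy α hα).mono fun t ht => by linarith [ha0 t]
  · refine le_of_forall_pos_le_add fun ε hε => ?_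
    -- The crude bound a T ≤ 2K₀ + PF²T is only linear in T, but its factor η is free; here η(PF² +
    -- 1) = ε.
    have hη : 0 < ε / (P * F ^ 2 + 1) := by positivity
    obtain ⟨K, hK⟩ := hweak β hβ _ hη
    set η := ε / (P * F ^ 2 + 1) with hηdef
    have h := le_of_le_integral (c := F ^ 2) (k := η * (2 * K₀) + K)
      (r := η * (P * F ^ 2) + M / (2 * β)) (p := β / 2) (q := S) ha hd (by positivity) hS
      fun T hT => ?_
    · have h2 : η * (P * F ^ 2) + η = ε := by rw [hηdef]; field_simp
      linarith
    · refine le_of_ae_le_of_continuousOn (fun T => F ^ 2 * T) (fun T => η * (2 * K₀) + K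
        + (η * (P * F ^ 2) + M / (2 * β)) * T + β / 2 * (∫ t in (0 : ℝ)..T, d t)
        + S * ∫ t in (0 : ℝ)..T, a t) (by fun_prop) ?_ ?_ hT
      · fun_prop
      filter_upwards [hK, hae, ae_restrict_mem measurableSet_Ioi] with T h1 h2 hT
      have h3 : 0 ≤ ∫ t in (0 : ℝ)..T, d t :=
        intervalIntegral.integral_nonneg (Set.mem_Ioi.1 hT).le fun t _ => hd0 t
      have h4 := mul_le_mul_of_nonneg_left (by linarith : a T ≤ 2 * K₀ + P * F ^ 2 * T) hη.le
      linarith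

theorem dissipation_bound {F A E L S M ν χ D : ℝ} (N : ℕ) (hF : 0 < F) (hA : 0 ≤ A) (hL : 0 < L)
    (hLS : L * S ≤ F)
    (hM : M ≤ F ^ 2 * (ν / L ^ 2 + χ * D / L ^ (2 * N + 2)))
    (h1 : ∀ α > 0, E ≤ α * F ^ 2 / 2 + 1 / (2 * α) * A)
    (h2 : ∀ β > 0, F ^ 2 ≤ M / (2 * β) + β / 2 * E + S * A) :
    0 < √A ∧ E ≤ (2 + 1 / (√A * L / ν) + 1 / (√A * L ^ (2 * N + 1) / (χ * D))) * (√A ^ 3 / L) := by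
  have hU : 0 < √A := by
    rw [Real.sqrt_pos]
    refine hA.lt_of_ne' ?_
    rintro rfl
    have hE : E ≤ 0 := by
      refine le_of_forall_pos_le_add fun ε hε => ?_
      -- With A = 0 this α gives E ≤ ε for every ε > 0.
      have := h1 (2 * ε / F ^ 2) (by positivity)
      rwa [div_mul_cancel₀ _ (by positivity), mul_zero, add_zero, mul_div_cancel_left₀ _ two_ne_zero,
        ← zero_add ε] at this
    -- This β is so large that M/(2β) ≤ F²/2, leaving the contradiction F² ≤ F²/2.
    have h3 := h2 ((|M| + 1) / F ^ 2) (by positivity)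
    have h4 : (|M| + 1) / F ^ 2 / 2 * E ≤ 0 := mul_nonpos_of_nonneg_of_nonpos (by positivity) hE
    have h5 : M / (2 * ((|M| + 1) / F ^ 2)) = F ^ 2 / 2 * (M / (|M| + 1)) := by field_simp
    have h6 : M / (|M| + 1) ≤ 1 := by
      rw [div_le_one (by positivity)]; linarith [le_abs_self M]
    have h7 := mul_le_mul_of_nonneg_left h6 (by positivity : 0 ≤ F ^ 2 / 2)
    nlinarith [pow_pos hF 2]
  refine ⟨hU, ?_⟩
  obtain ⟨U, hUd⟩ : ∃ U, U = √A := ⟨_, rfl⟩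
  have hAU : A = U ^ 2 := by rw [hUd, Real.sq_sqrt hA]
  rw [← hUd] at hU ⊢
  subst hAU
  set m := ν / L ^ 2 + χ * D / L ^ (2 * N + 2) with hm
  -- The value α = U/F minimizes the right side of `h1`.
  have hE : E ≤ F * U := by
    refine (h1 (U / F) (by positivity)).trans_eq ?_
    field_simp; ring
  have hS : S ≤ F / L := by rw [le_div_iff₀ hL]; linarith
  have hkey : F * U ≤ E / 2 + U ^ 3 / L + U ^ 2 * m / 2 := by
    -- With β = F/U, multiplication by U/F leaves exactly E/2, half of which type `hE` lets the left
    -- side absorb at the end.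
    have h3 := mul_le_mul_of_nonneg_left (h2 (F / U) (by positivity)) (by positivity : 0 ≤ U / F)
    have h4 : U / F * F ^ 2 = F * U := by field_simp
    have h5 : U / F * (M / (2 * (F / U)) + F / U / 2 * E + S * U ^ 2)
        = U ^ 2 / (2 * F ^ 2) * M + E / 2 + U ^ 3 / F * S := by field_simp
    rw [h4, h5] at h3
    have h6 := mul_le_mul_of_nonneg_left hM (by positivity : 0 ≤ U ^ 2 / (2 * F ^ 2))
    have h7 := mul_le_mul_of_nonneg_left hS (by positivity : 0 ≤ U ^ 3 / F)
    have h8 : U ^ 2 / (2 * F ^ 2) * (F ^ 2 * m) = U ^ 2 * m / 2 := by field_simp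
    have h9 : U ^ 3 / F * (F / L) = U ^ 3 / L := by field_simp
    linarith
  have hfin : (2 + 1 / (U * L / ν) + 1 / (U * L ^ (2 * N + 1) / (χ * D))) * (U ^ 3 / L)
      = 2 * (U ^ 3 / L) + U ^ 2 * m := by
    rw [hm]; field_simp; ring
  rw [hfin]; linarith

end Averages

/-! ### Leray-Hopf solutions -/

section LerayHopf

variable {ℓ ν χ δ : ℝ} {N : ℕ} {f u₀ : SmoothField ℓ} {u : ℝ → L2 ℓ} {Du : ℝ → L2Grad ℓ}

theorem norm_sq_eq_integral (v : L2 ℓ) : ‖v‖ ^ 2 = ∫ x in box ℓ, ‖v x‖ ^ 2 := by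
  rw [← real_inner_self_eq_norm_sq, L2.inner_def]
  simp only [real_inner_self_eq_norm_sq]

theorem clm_apply_eq_sum {F : Type*} [NormedAddCommGroup F] [NormedSpace ℝ F] (A : E3 →L[ℝ] F)
    (y : E3) : A y = ∑ i, y i • A (e i) := by
  have h : y = ∑ i, y i • e i := by
    ext i; fin_cases i <;> simp [Fin.sum_univ_three]
  conv_lhs => rw [h]
  simp only [map_sum, map_smul]

theorem norm_fderiv_apply_le (f : SmoothField ℓ) (x y : E3) :
    ‖fderiv ℝ f x y‖ ≤ √(∑ i, ‖f.pderiv i x‖ ^ 2) * ‖y‖ := by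
  have h : ‖fderiv ℝ f x y‖ ≤ ∑ i, ‖y i‖ * ‖f.pderiv i x‖ := by
    rw [clm_apply_eq_sum (fderiv ℝ f x) y]
    refine (norm_sum_le _ _).trans_eq ?_
    simp only [norm_smul]
    rfl
  refine h.trans ?_
  rw [EuclideanSpace.norm_eq y, mul_comm]
  exact Real.sum_mul_le_sqrt_mul_sqrt _ _ _

theorem abs_convection_le (v : L2 ℓ) (f : SmoothField ℓ) :
    |convection v f| ≤ gradSup f * ‖v‖ ^ 2 := by
  rw [norm_sq_eq_integral, ← integral_const_mul, convection, ← Real.norm_eq_abs]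
  have hi : Integrable (fun x => gradSup f * ‖v x‖ ^ 2) (boxMeasure ℓ) :=
    ((Lp.memLp v).integrable_norm_pow (by norm_num)).const_mul _
  refine norm_integral_le_of_norm_le hi ?_
  filter_upwards [gradNorm_le_gradSup f] with x hx
  refine (norm_inner_le_norm _ _).trans ?_
  rw [sq, ← mul_assoc]
  refine mul_le_mul_of_nonneg_right ((norm_fderiv_apply_le f x _).trans ?_) (norm_nonneg _)
  exact mul_le_mul_of_nonneg_right hx (norm_nonneg _)

theorem young_inner {H : Type*} [NormedAddCommGroup H] [InnerProductSpace ℝ H] (x y : H) {β : ℝ}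
    (hβ : 0 < β) : |inner ℝ x y| ≤ β / 2 * ‖x‖ ^ 2 + 1 / (2 * β) * ‖y‖ ^ 2 := by
  refine (abs_real_inner_le_norm x y).trans ?_
  have h : 0 ≤ (β * ‖x‖ - ‖y‖) ^ 2 / (2 * β) := by positivity
  have h2 : (β * ‖x‖ - ‖y‖) ^ 2 / (2 * β)
      = β / 2 * ‖x‖ ^ 2 + 1 / (2 * β) * ‖y‖ ^ 2 - ‖x‖ * ‖y‖ := by field_simp; ring
  linarith

theorem intervalIntegrable_norm_sq {H : Type*} [NormedAddCommGroup H] {v : ℝ → H} {T : ℝ}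
    (hT : 0 < T) (hv : MemLp v 2 (volume.restrict (Set.Ioc 0 T))) :
    IntervalIntegrable (fun t => ‖v t‖ ^ 2) volume 0 T := by
  rw [intervalIntegrable_iff_integrableOn_Ioc_of_le hT.le]
  exact hv.integrable_norm_pow two_ne_zero

namespace IsLerayHopfSolution

theorem memLp_two (h : IsLerayHopfSolution ℓ ν χ δ N f u₀ u Du) {T : ℝ} (hT : 0 < T) :
    MemLp u 2 (volume.restrict (Set.Ioc 0 T)) :=
  (h.memLp_u T hT).mono_exponent le_top

theorem intervalIntegrable_norm_sq_opB (h : IsLerayHopfSolution ℓ ν χ δ N f u₀ u Du) {T : ℝ}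
    (hT : 0 < T) : IntervalIntegrable (fun t => ‖opB ℓ δ N (u t)‖ ^ 2) volume 0 T :=
  intervalIntegrable_norm_sq hT ((opB ℓ δ N).comp_memLp' (h.memLp_two hT))

theorem intervalIntegrable_inner (h : IsLerayHopfSolution ℓ ν χ δ N f u₀ u Du) {T : ℝ}
    (hT : 0 < T) (v : L2 ℓ) : IntervalIntegrable (fun t => inner ℝ v (u t)) volume 0 T := by
  rw [intervalIntegrable_iff_integrableOn_Ioc_of_le hT.le]
  exact ((h.memLp_two hT).integrable (by norm_num)).const_inner v

theorem intervalIntegrable_meanSquare (h : IsLerayHopfSolution ℓ ν χ δ N f u₀ u Du) {T : ℝ}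
    (hT : 0 < T) : IntervalIntegrable (meanSquare u) volume 0 T :=
  (intervalIntegrable_norm_sq hT (h.memLp_two hT)).const_mul _

theorem intervalIntegrable_dissipation (h : IsLerayHopfSolution ℓ ν χ δ N f u₀ u Du) (hδ : 0 < δ)
    {T : ℝ} (hT : 0 < T) : IntervalIntegrable (dissipation ℓ ν χ δ N u Du) volume 0 T := by
  unfold dissipation
  simp only [inner_fluctuation_self hδ]
  exact ((((intervalIntegrable_norm_sq hT (h.memLp_Du T hT)).const_mul ν).const_mul _)).add
    ((((h.intervalIntegrable_norm_sq_opB hT).const_mul _).const_mul χ).const_mul _)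

/-- Squared Poincaré inequality, whence 9ℓ²; the relaxation part of the dissipation is nonnegative
and can be discarded. -/
theorem meanSquare_le (h : IsLerayHopfSolution ℓ ν χ δ N f u₀ u Du) (hℓ : 0 < ℓ) (hν : 0 < ν)
    (hχ : 0 < χ) (hδ : 0 < δ) : ∀ᵐ t ∂volume.restrict (Set.Ioi 0),
      meanSquare u t ≤ 9 * ℓ ^ 2 / ν * dissipation ℓ ν χ δ N u Du t := by
  filter_upwards [h.weakGradient, h.meanZero] with t h1 h2
  have h3 := pow_le_pow_left₀ (norm_nonneg _) (h1.norm_le hℓ h2) 2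
  have hV := vol_pos hℓ
  have h4 := inner_fluctuation_self_nonneg (N := N) hδ (u t)
  have h5 : 1 / vol ℓ * (ν * ‖Du t‖ ^ 2) ≤ dissipation ℓ ν χ δ N u Du t :=
    le_add_of_nonneg_right (by positivity)
  have h6 := mul_le_mul_of_nonneg_left h5 (by positivity : 0 ≤ 9 * ℓ ^ 2 / ν)
  have h7 := mul_le_mul_of_nonneg_left h3 (by positivity : 0 ≤ 1 / vol ℓ)
  refine h7.trans (le_trans (le_of_eq ?_) h6)
  field_simp; ring

theorem energy_le (h : IsLerayHopfSolution ℓ ν χ δ N f u₀ u Du) (hℓ : 0 < ℓ)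
    {α : ℝ} (hα : 0 < α) : ∀ᵐ T ∂volume.restrict (Set.Ioi 0),
      meanSquare u T / 2 + ∫ t in (0 : ℝ)..T, dissipation ℓ ν χ δ N u Du t ≤
        1 / vol ℓ * ‖u₀.toL2‖ ^ 2 / 2 + α * forceScale f ^ 2 / 2 * T
          + 1 / (2 * α) * ∫ t in (0 : ℝ)..T, meanSquare u t := by
  have hV := vol_pos hℓ
  filter_upwards [h.energy, ae_restrict_mem measurableSet_Ioi] with T h1 hT
  have hT : 0 < T := hT
  have h2 : ∫ t in (0 : ℝ)..T, dissipation ℓ ν χ δ N u Du t = 1 / vol ℓ *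
      ∫ s in (0 : ℝ)..T, (ν * ‖Du s‖ ^ 2 + χ * inner ℝ (fluctuation ℓ δ N (u s)) (u s)) := by
    rw [← intervalIntegral.integral_const_mul]
    exact intervalIntegral.integral_congr fun t _ => (mul_add _ _ _).symm
  have h3 : ∫ s in (0 : ℝ)..T, inner ℝ f.toL2 (u s) ≤
      α / 2 * ‖f.toL2‖ ^ 2 * T + 1 / (2 * α) * ∫ t in (0 : ℝ)..T, ‖u t‖ ^ 2 := by
    have hi := (intervalIntegrable_norm_sq hT (h.memLp_two hT)).const_mul (1 / (2 * α))
    have := intervalIntegral.integral_mono_on hT.le (h.intervalIntegrable_inner hT f.toL2)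
      ((intervalIntegrable_const (c := α / 2 * ‖f.toL2‖ ^ 2)).add hi)
      fun t _ => (le_abs_self _).trans (young_inner f.toL2 (u t) hα)
    rw [intervalIntegral.integral_add intervalIntegrable_const hi, intervalIntegral.integral_const,
      intervalIntegral.integral_const_mul, sub_zero, smul_eq_mul] at this
    linarith
  have h4 := mul_le_mul_of_nonneg_left (h1.trans (add_le_add_right h3 _))
    (by positivity : 0 ≤ 1 / vol ℓ)
  rw [h2, forceScale_sq hℓ]
  unfold meanSquare
  rw [intervalIntegral.integral_const_mul]
  linarith

/-- The weak form is tested with f. The same β is used for the viscous and the relaxation term so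
that the quadratic parts in u add up to the dissipation. -/
theorem weak_le (h : IsLerayHopfSolution ℓ ν χ δ N f u₀ u Du) (hℓ : 0 < ℓ) (hν : 0 < ν)
    (hχ : 0 < χ) (hδ : 0 < δ) (hf : f.IsSolenoidal) {β η : ℝ} (hβ : 0 < β) (hη : 0 < η) :
    ∃ K, ∀ᵐ T ∂volume.restrict (Set.Ioi 0),
      forceScale f ^ 2 * T ≤ η * meanSquare u T + K
        + β / 2 * (∫ t in (0 : ℝ)..T, dissipation ℓ ν χ δ N u Du t)
        + gradSup f * (∫ t in (0 : ℝ)..T, meanSquare u t)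
        + (ν * (1 / vol ℓ * ‖f.grad‖ ^ 2)
          + χ * δ ^ (2 * N + 2) * (1 / vol ℓ * ‖opB ℓ δ N f.toL2‖ ^ 2)) / (2 * β) * T := by
  have hV := vol_pos hℓ
  set M := ν * (1 / vol ℓ * ‖f.grad‖ ^ 2)
    + χ * δ ^ (2 * N + 2) * (1 / vol ℓ * ‖opB ℓ δ N f.toL2‖ ^ 2) with hM
  refine ⟨1 / vol ℓ * (1 / (4 * η) * ‖f.toL2‖ ^ 2 - inner ℝ u₀.toL2 f.toL2), ?_⟩
  filter_upwards [h.weakForm f hf, ae_restrict_mem measurableSet_Ioi] with T h1 hT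
  have hT : 0 < T := hT
  have hS := gradSup_nonneg f
  have hpt : ∀ s, ν * inner ℝ (Du s) f.grad - convection (u s) f
      + χ * inner ℝ (fluctuation ℓ δ N (u s)) f.toL2 ≤ vol ℓ * (β / 2 *
        dissipation ℓ ν χ δ N u Du s + gradSup f * meanSquare u s + M / (2 * β)) := by
    intro s
    have e1 := (le_abs_self _).trans (young_inner (Du s) f.grad hβ)
    have e2 := neg_le_of_abs_le (abs_convection_le (u s) f)
    have e3 := (le_abs_self _).trans (young_inner (opB ℓ δ N (u s)) (opB ℓ δ N f.toL2) hβ)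
    have e4 := mul_le_mul_of_nonneg_left e1 hν.le
    have e5 := mul_le_mul_of_nonneg_left e3 (by positivity : 0 ≤ χ * δ ^ (2 * N + 2))
    unfold dissipation meanSquare
    rw [inner_fluctuation hδ, inner_fluctuation_self hδ, hM]
    have e6 : vol ℓ * (β / 2 * (1 / vol ℓ * (ν * ‖Du s‖ ^ 2)
        + 1 / vol ℓ * (χ * (δ ^ (2 * N + 2) * ‖opB ℓ δ N (u s)‖ ^ 2)))
        + gradSup f * (1 / vol ℓ * ‖u s‖ ^ 2) + (ν * (1 / vol ℓ * ‖f.grad‖ ^ 2)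
          + χ * δ ^ (2 * N + 2) * (1 / vol ℓ * ‖opB ℓ δ N f.toL2‖ ^ 2)) / (2 * β))
        = ν * (β / 2 * ‖Du s‖ ^ 2 + 1 / (2 * β) * ‖f.grad‖ ^ 2) + gradSup f * ‖u s‖ ^ 2
          + χ * δ ^ (2 * N + 2) * (β / 2 * ‖opB ℓ δ N (u s)‖ ^ 2
            + 1 / (2 * β) * ‖opB ℓ δ N f.toL2‖ ^ 2) := by
      field_simp; ring
    rw [e6]; linarith
  have hdi := (h.intervalIntegrable_dissipation hδ hT).const_mul (β / 2)
  have hai := (h.intervalIntegrable_meanSquare hT).const_mul (gradSup f)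
  have hri := (hdi.add hai).add (intervalIntegrable_const (c := M / (2 * β)))
  have h2 : ∫ s in (0 : ℝ)..T, (ν * inner ℝ (Du s) f.grad - convection (u s) f
      + χ * inner ℝ (fluctuation ℓ δ N (u s)) f.toL2) ≤ ∫ s in (0 : ℝ)..T, vol ℓ * (β / 2 *
        dissipation ℓ ν χ δ N u Du s + gradSup f * meanSquare u s + M / (2 * β)) := by
    rw [intervalIntegral.integral_of_le hT.le, intervalIntegral.integral_of_le hT.le]
    -- No integrability of the tested integrand is needed: if it fails, the integral is 0 by
    -- convention and the right side is nonnegative.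
    by_cases hint : IntegrableOn (fun s => ν * inner ℝ (Du s) f.grad - convection (u s) f
      + χ * inner ℝ (fluctuation ℓ δ N (u s)) f.toL2) (Set.Ioc 0 T)
    · exact integral_mono hint ((intervalIntegrable_iff_integrableOn_Ioc_of_le hT.le).1
        (hri.const_mul (vol ℓ))) hpt
    · rw [integral_undef hint]
      refine integral_nonneg fun s => ?_
      have := inner_fluctuation_self_nonneg (N := N) hδ (u s)
      simp only [Pi.zero_apply, dissipation, meanSquare]
      positivity
  rw [intervalIntegral.integral_const_mul, intervalIntegral.integral_add (hdi.add hai)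
    intervalIntegrable_const, intervalIntegral.integral_add hdi hai,
    intervalIntegral.integral_const_mul, intervalIntegral.integral_const_mul,
    intervalIntegral.integral_const, sub_zero, smul_eq_mul] at h2
  rw [intervalIntegral.integral_const, sub_zero, smul_eq_mul, real_inner_self_eq_norm_sq] at h1
  -- Parameter 2η puts the coefficient η on ‖u(T)‖²; the remainder does not depend on T and goes
  -- into K.
  have h3 := (le_abs_self _).trans (young_inner (u T) f.toL2 (by positivity : 0 < 2 * η))
  have h4 : T * ‖f.toL2‖ ^ 2 ≤ vol ℓ * (η * meanSquare u T
      + 1 / vol ℓ * (1 / (4 * η) * ‖f.toL2‖ ^ 2 - inner ℝ u₀.toL2 f.toL2)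
        + β / 2 * (∫ t in (0 : ℝ)..T, dissipation ℓ ν χ δ N u Du t)
        + gradSup f * (∫ t in (0 : ℝ)..T, meanSquare u t) + M / (2 * β) * T) := by
    have e1 : vol ℓ * (η * meanSquare u T) = 2 * η / 2 * ‖u T‖ ^ 2 := by
      unfold meanSquare; field_simp
    have e2 : vol ℓ * (1 / vol ℓ * (1 / (4 * η) * ‖f.toL2‖ ^ 2 - inner ℝ u₀.toL2 f.toL2))
        = 1 / (2 * (2 * η)) * ‖f.toL2‖ ^ 2 - inner ℝ u₀.toL2 f.toL2 := by field_simp; ring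
    simp only [mul_add] at h2 ⊢
    rw [e1, e2]; linarith
  have h5 := mul_le_mul_of_nonneg_left h4 (by positivity : 0 ≤ 1 / vol ℓ)
  rw [← mul_assoc, ← mul_assoc, one_div_mul_cancel hV.ne', one_mul, mul_right_comm,
    ← forceScale_sq hℓ] at h5
  exact h5

theorem dissipation_le (h : IsLerayHopfSolution ℓ ν χ δ N f u₀ u Du) (hℓ : 0 < ℓ) (hν : 0 < ν)
    (hχ : 0 < χ) (hδ : 0 < δ) (hf : f.IsSolenoidal) (hf0 : ∃ x, f x ≠ 0) :
    HasTimeAvg (meanSquare u) ∧ HasTimeAvg (dissipation ℓ ν χ δ N u Du) ∧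
    0 < velocityScale u ∧ timeAvg (dissipation ℓ ν χ δ N u Du) ≤
      (2 + 1 / reynolds (velocityScale u) (lengthScale δ N f) ν
        + 1 / relaxationNumber (velocityScale u) (lengthScale δ N f) χ δ N)
        * (velocityScale u ^ 3 / lengthScale δ N f) := by
  have hV := vol_pos hℓ
  have ha0 : ∀ t, 0 ≤ meanSquare u t := fun t => by unfold meanSquare; positivity
  have hd0 : ∀ t, 0 ≤ dissipation ℓ ν χ δ N u Du t := fun t => by
    have := inner_fluctuation_self_nonneg (N := N) hδ (u t)
    unfold dissipation; positivity
  obtain ⟨ha, hd, h1, h2⟩ := timeAvg_bounds ha0 hd0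
    (fun T hT => h.intervalIntegrable_meanSquare hT)
    (fun T hT => h.intervalIntegrable_dissipation hδ hT) (by positivity) (gradSup_nonneg f)
    (h.meanSquare_le hℓ hν hχ hδ) (fun α hα => h.energy_le hℓ hα)
    (fun β hβ η hη => h.weak_le hℓ hν hχ hδ hf hβ hη)
  have hL := lengthScale_pos (N := N) hℓ hδ hf hf0
  have hg : 1 / vol ℓ * ‖f.grad‖ ^ 2 ≤ forceScale f ^ 2 / lengthScale δ N f ^ 2 := by
    rw [le_div_iff₀ (by positivity), mul_comm]
    exact lengthScale_grad_le hℓ hδ hf hf0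
  have hB : 1 / vol ℓ * ‖opB ℓ δ N f.toL2‖ ^ 2
      ≤ forceScale f ^ 2 / lengthScale δ N f ^ (2 * N + 2) := by
    rw [le_div_iff₀ (by positivity), mul_comm]
    exact lengthScale_opB_le hℓ hδ hf hf0
  have hM := add_le_add (mul_le_mul_of_nonneg_left hg hν.le)
    (mul_le_mul_of_nonneg_left hB (by positivity : 0 ≤ χ * δ ^ (2 * N + 2)))
  obtain ⟨hU, hE⟩ := dissipation_bound N (forceScale_pos hℓ hf0) (ha.timeAvg_nonneg ha0) hL
    (ν := ν) (χ := χ) (D := δ ^ (2 * N + 2)) (lengthScale_gradSup_le hℓ hf hf0)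
    (hM.trans_eq (by ring)) h1 h2
  exact ⟨ha, hd, hU, hE⟩

end IsLerayHopfSolution

end LerayHopf

/-! ### Integral identities for divergence free fields -/

section Identities

variable {ℓ : ℝ} {w b : E3 → E3}

theorem contDiff_coord {n : WithTop ℕ∞} (hw : ContDiff ℝ n w) (i : Fin 3) :
    ContDiff ℝ n fun x => w x i :=
  (EuclideanSpace.proj (𝕜 := ℝ) i).contDiff.comp hw

theorem fderiv_coord (hw : Differentiable ℝ w) (i : Fin 3) (x y : E3) :
    fderiv ℝ (fun x => w x i) x y = fderiv ℝ w x y i := by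
  have h := (EuclideanSpace.proj (𝕜 := ℝ) i).hasFDerivAt.comp x (hw x).hasFDerivAt
  exact congrArg (fun A : E3 →L[ℝ] ℝ => A y) h.fderiv

/-- The convective term is antisymmetric. -/
theorem integral_inner_convective (hℓ : 0 < ℓ) (hw : ContDiff ℝ 1 w) (hb : ContDiff ℝ 1 b)
    (hpw : IsPeriodic ℓ w) (hpb : IsPeriodic ℓ b) (hdiv : ∀ x, divergence w x = 0) :
    ∫ x in box ℓ, inner ℝ (fderiv ℝ w x (w x)) (b x)
      = -∫ x in box ℓ, inner ℝ (fderiv ℝ b x (w x)) (w x) := by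
  have hcw := hw.continuous
  have hcb := hb.continuous
  have hcw' := hw.continuous_fderiv one_ne_zero
  have hcb' := hb.continuous_fderiv one_ne_zero
  have hdw := hw.differentiable one_ne_zero
  have hdb := hb.differentiable one_ne_zero
  have hci := fun i => (contDiff_coord hw i).continuous
  -- Integration by parts in direction i; summed over i, the terms with a derivative of w x i form
  -- the divergence of w and vanish.
  have h1 : ∀ i, ∫ x in box ℓ, inner ℝ (w x i • b x) (fderiv ℝ w x (e i))
      = -∫ x in box ℓ, (fderiv ℝ w x (e i) i * inner ℝ (b x) (w x)
        + inner ℝ (w x i • fderiv ℝ b x (e i)) (w x)) := by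
    intro i
    rw [setIntegral_inner_fderiv (a := fun x => w x i • b x) hℓ ((contDiff_coord hw i).smul hb) hw
      (fun j x => by simp only [hpw j x, hpb j x]) hpw (e i)]
    congr 2
    ext x
    rw [fderiv_fun_smul ((contDiff_coord hw i).differentiable one_ne_zero x) (hdb x), add_comm]
    simp only [add_apply, smul_apply,
      ContinuousLinearMap.smulRight_apply, inner_add_left, fderiv_coord hdw,
      real_inner_smul_left]
  have h2 := Finset.sum_congr rfl fun (i : Fin 3) (_ : i ∈ Finset.univ) => h1 i
  rw [Finset.sum_neg_distrib, ← integral_finsetSum _ fun i _ => integrableOn_box (by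
      have := hci i; fun_prop),
    ← integral_finsetSum _ fun i _ => integrableOn_box (by have := hci i; fun_prop)] at h2
  have h3 : ∀ x, ∑ i, inner ℝ (w x i • b x) (fderiv ℝ w x (e i))
      = inner ℝ (fderiv ℝ w x (w x)) (b x) := fun x => by
    rw [clm_apply_eq_sum (fderiv ℝ w x) (w x), sum_inner]
    refine Finset.sum_congr rfl fun i _ => ?_
    rw [real_inner_smul_left, real_inner_smul_left, real_inner_comm]
  have h4 : ∀ x, ∑ i, (fderiv ℝ w x (e i) i * inner ℝ (b x) (w x)
      + inner ℝ (w x i • fderiv ℝ b x (e i)) (w x)) = inner ℝ (fderiv ℝ b x (w x)) (w x) :=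
    fun x => by
      have := hdiv x
      rw [divergence] at this
      rw [Finset.sum_add_distrib, ← Finset.sum_mul, this, zero_mul, zero_add, ← sum_inner,
        ← clm_apply_eq_sum (fderiv ℝ b x) (w x)]
  simpa only [h3, h4] using h2

theorem integral_inner_convective_self (hℓ : 0 < ℓ) (hw : ContDiff ℝ 1 w)
    (hpw : IsPeriodic ℓ w) (hdiv : ∀ x, divergence w x = 0) :
    ∫ x in box ℓ, inner ℝ (fderiv ℝ w x (w x)) (w x) = 0 := by
  have := integral_inner_convective hℓ hw hw hpw hpw hdiv
  linarith

/-- The divergence of p b integrates to 0 by periodicity and equals b·∇p when b is divergence free;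
this removes the pressure. -/
theorem integral_inner_gradient (hℓ : 0 < ℓ) {p : E3 → ℝ} (hp : ContDiff ℝ 1 p)
    (hb : ContDiff ℝ 1 b) (hpp : IsPeriodic ℓ p) (hpb : IsPeriodic ℓ b)
    (hdiv : ∀ x, divergence b x = 0) : ∫ x in box ℓ, inner ℝ ((∇ p) x) (b x) = 0 := by
  have hcp := hp.continuous
  have hcb := hb.continuous
  have hcp' := hp.continuous_fderiv one_ne_zero
  have hcb' := hb.continuous_fderiv one_ne_zero
  have hdb := hb.differentiable one_ne_zero
  have hci := fun i => (contDiff_coord hb i).continuous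
  have h1 : ∀ i, ∫ x in box ℓ, (p x * fderiv ℝ b x (e i) i + b x i * fderiv ℝ p x (e i)) = 0 := by
    intro i
    rw [← setIntegral_fderiv_eq_zero hℓ (hp.mul (contDiff_coord hb i))
      (fun j x => by simp only [hpp j x, hpb j x]) (e i)]
    congr 1
    ext x
    rw [fderiv_fun_mul (hp.differentiable one_ne_zero x)
      ((contDiff_coord hb i).differentiable one_ne_zero x)]
    simp only [add_apply, smul_apply, smul_eq_mul,
      fderiv_coord hdb]
  have h2 := Finset.sum_congr rfl fun (i : Fin 3) (_ : i ∈ Finset.univ) => h1 i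
  rw [Finset.sum_const_zero, ← integral_finsetSum _ fun i _ => integrableOn_box (by
      have := hci i; fun_prop)] at h2
  rw [← h2]
  congr 1
  ext x
  have := hdiv x
  rw [divergence] at this
  rw [Finset.sum_add_distrib, ← Finset.mul_sum, this, mul_zero, zero_add, inner_gradient_left,
    clm_apply_eq_sum (fderiv ℝ p x) (b x)]
  rfl

theorem laplacian_eq_sum (hw : ContDiff ℝ 2 w) (x : E3) :
    (Δ w) x = ∑ i, fderiv ℝ (fun y => fderiv ℝ w y (e i)) x (e i) := by
  rw [InnerProductSpace.laplacian_eq_iteratedFDeriv_orthonormalBasis w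
    (EuclideanSpace.basisFun (Fin 3) ℝ)]
  refine Finset.sum_congr rfl fun i _ => ?_
  have hd : DifferentiableAt ℝ (fderiv ℝ w) x :=
    (hw.fderiv_right (m := 1) (by norm_num)).differentiable one_ne_zero x
  rw [iteratedFDeriv_two_apply, fderiv_clm_apply hd (differentiableAt_const _)]
  simp

theorem integral_inner_laplacian (hℓ : 0 < ℓ) (hw : ContDiff ℝ 2 w) (hb : ContDiff ℝ 1 b)
    (hpw : IsPeriodic ℓ w) (hpb : IsPeriodic ℓ b) :
    ∫ x in box ℓ, inner ℝ ((Δ w) x) (b x)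
      = -∑ i, ∫ x in box ℓ, inner ℝ (fderiv ℝ w x (e i)) (fderiv ℝ b x (e i)) := by
  have hd : ∀ i, ContDiff ℝ 1 fun x => fderiv ℝ w x (e i) := fun i =>
    (hw.fderiv_right (m := 1) (by norm_num)).clm_apply contDiff_const
  have hd' := fun i => (hd i).continuous_fderiv one_ne_zero
  have hcb := hb.continuous
  simp only [setIntegral_inner_fderiv hℓ (hd _) hb
    (fun j x => congrArg (fun A : E3 →L[ℝ] E3 => A _) (hpw.fderiv j x)) hpb,
    Finset.sum_neg_distrib, neg_neg]
  rw [← integral_finsetSum _ fun i _ => integrableOn_box (by have := hd' i; fun_prop)]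
  simp only [laplacian_eq_sum hw, sum_inner]

theorem continuous_laplacian (hw : ContDiff ℝ 2 w) : Continuous (Δ w) := by
  have hd : ∀ i, ContDiff ℝ 1 fun x => fderiv ℝ w x (e i) := fun i =>
    (hw.fderiv_right (m := 1) (by norm_num)).clm_apply contDiff_const
  have hd' := fun i => (hd i).continuous_fderiv one_ne_zero
  rw [funext (laplacian_eq_sum hw)]
  fun_prop

theorem continuous_gradient {p : E3 → ℝ} (hp : ContDiff ℝ 1 p) : Continuous (∇ p) :=
  (InnerProductSpace.toDual ℝ E3).symm.continuous.comp (hp.continuous_fderiv one_ne_zero)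

end Identities

/-! ### Classical solutions are Leray-Hopf solutions -/

namespace IsClassicalSolution

variable {ℓ ν χ δ : ℝ} {N : ℕ} {f u₀ : SmoothField ℓ} {u : ℝ → L2 ℓ} {Du : ℝ → L2Grad ℓ}
  {w : ℝ → E3 → E3} {p : ℝ → E3 → ℝ}

theorem continuousOn_u (h : IsClassicalSolution ℓ ν χ δ N f u₀ u Du w p) :
    ContinuousOn u (Set.Ici 0) :=
  continuousOn_curve h.continuous_w h.u_eq

theorem continuousOn_Du (h : IsClassicalSolution ℓ ν χ δ N f u₀ u Du w p) :
    ContinuousOn Du (Set.Ioi 0) := by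
  have h1 : ∀ i, ContinuousOn (fun t => Du t i) (Set.Ioi 0) := fun i =>
    continuousOn_curve (W := fun t x => fderiv ℝ (w t) x (e i))
      (h.continuous_dx.clm_apply continuousOn_const) fun t ht => h.Du_eq t ht i
  exact (PiLp.continuous_toLp 2 fun _ : Fin 3 => L2 ℓ).comp_continuousOn (continuousOn_pi.2 h1)

theorem contDiff_one (h : IsClassicalSolution ℓ ν χ δ N f u₀ u Du w p) {t : ℝ} (ht : 0 < t) :
    ContDiff ℝ 1 (w t) :=
  (h.contDiff_w t ht).of_le one_le_two

theorem continuous_deriv (h : IsClassicalSolution ℓ ν χ δ N f u₀ u Du w p) {t : ℝ} (ht : 0 < t) :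
    Continuous fun x => deriv (fun s => w s x) t := by
  rw [← continuousOn_univ]
  exact h.continuous_dt.comp (f := fun x : E3 => (t, x)) (by fun_prop)
    fun x _ => ⟨ht, Set.mem_univ x⟩

/-- Makes u a C¹ curve in L² for t > 0, so that the equation can be paired with fields by the
product rule. -/
theorem exists_deriv (h : IsClassicalSolution ℓ ν χ δ N f u₀ u Du w p) :
    ∃ v : ℝ → L2 ℓ, (∀ t > 0, v t =ᵐ[boxMeasure ℓ] fun x => deriv (fun s => w s x) t) ∧
      (∀ t > 0, HasDerivAt u (v t) t) ∧ ContinuousOn v (Set.Ioi 0) := by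
  have h1 : ∀ t, ∃ z : L2 ℓ, 0 < t → z =ᵐ[boxMeasure ℓ] fun x => deriv (fun s => w s x) t := by
    intro t
    by_cases ht : 0 < t
    · exact ⟨clsL2 ℓ _ (h.continuous_deriv ht), fun _ => coeFn_clsL2 _⟩
    · exact ⟨0, fun h => absurd h ht⟩
  choose v hv using h1
  refine ⟨v, hv, fun t ht => ?_, continuousOn_curve h.continuous_dt hv⟩
  exact hasDerivAt_curve isOpen_Ioi (fun s hs x => (h.differentiable_t s hs x).hasDerivAt)
    h.continuous_dt (fun s hs => h.u_eq s (le_of_lt hs)) hv ht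

/-- The equation tested against a divergence free field. -/
theorem inner_deriv (h : IsClassicalSolution ℓ ν χ δ N f u₀ u Du w p) (hℓ : 0 < ℓ) {t : ℝ}
    (ht : 0 < t) {v c : L2 ℓ} {g : L2Grad ℓ} {b : E3 → E3}
    (hv : v =ᵐ[boxMeasure ℓ] fun x => deriv (fun s => w s x) t) (hb : ContDiff ℝ 1 b)
    (hpb : IsPeriodic ℓ b) (hdiv : ∀ x, divergence b x = 0) (hc : c =ᵐ[boxMeasure ℓ] b)
    (hg : ∀ i, g i =ᵐ[boxMeasure ℓ] fun x => fderiv ℝ b x (e i)) :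
    inner ℝ v c = inner ℝ f.toL2 c - (ν * inner ℝ (Du t) g
      - (∫ x in box ℓ, inner ℝ (fderiv ℝ b x (w t x)) (w t x))
      + χ * inner ℝ (fluctuation ℓ δ N (u t)) c) := by
  have hw := h.contDiff_one ht
  have hcw := hw.continuous
  have hcw' := hw.continuous_fderiv one_ne_zero
  have hcb := hb.continuous
  have hcf := f.continuous
  have hcl := continuous_laplacian (h.contDiff_w t ht)
  have hcg := continuous_gradient (h.contDiff_p t ht)
  have hfl : Integrable (fun x => inner ℝ (fluctuation ℓ δ N (u t) x) (b x)) (boxMeasure ℓ) := by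
    refine (L2.integrable_inner (𝕜 := ℝ) (fluctuation ℓ δ N (u t)) c).congr ?_
    filter_upwards [hc] with x hx
    rw [hx]
  have e1 : inner ℝ v c = ∫ x in box ℓ, (inner ℝ (f x) (b x)
      - inner ℝ (fderiv ℝ (w t) x (w t x)) (b x) + ν * inner ℝ ((Δ (w t)) x) (b x)
      - inner ℝ ((∇ (p t)) x) (b x) - χ * inner ℝ (fluctuation ℓ δ N (u t) x) (b x)) := by
    rw [inner_L2_eq hv hc]
    refine integral_congr_ae ?_
    filter_upwards [h.equation t ht] with x hx
    rw [← hx]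
    simp only [inner_add_left, inner_sub_left, real_inner_smul_left]
    ring
  have i1 : IntegrableOn (fun x => inner ℝ (f x) (b x)) (box ℓ) :=
    integrableOn_box (by fun_prop)
  have i2 : IntegrableOn (fun x => inner ℝ (fderiv ℝ (w t) x (w t x)) (b x)) (box ℓ) :=
    integrableOn_box (by fun_prop)
  have i3 : IntegrableOn (fun x => ν * inner ℝ ((Δ (w t)) x) (b x)) (box ℓ) :=
    integrableOn_box (by fun_prop)
  have i4 : IntegrableOn (fun x => inner ℝ ((∇ (p t)) x) (b x)) (box ℓ) :=
    integrableOn_box (by fun_prop)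
  have e2 : inner ℝ (Du t) g
      = ∑ i, ∫ x in box ℓ, inner ℝ (fderiv ℝ (w t) x (e i)) (fderiv ℝ b x (e i)) := by
    rw [PiLp.inner_apply]
    exact Finset.sum_congr rfl fun i _ => inner_L2_eq (h.Du_eq t ht i) (hg i)
  have j2 : IntegrableOn (fun x => inner ℝ (f x) (b x)
      - inner ℝ (fderiv ℝ (w t) x (w t x)) (b x)) (box ℓ) := i1.sub i2
  have j3 : IntegrableOn (fun x => inner ℝ (f x) (b x)
      - inner ℝ (fderiv ℝ (w t) x (w t x)) (b x) + ν * inner ℝ ((Δ (w t)) x) (b x)) (box ℓ) :=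
    j2.add i3
  have j4 : IntegrableOn (fun x => inner ℝ (f x) (b x)
      - inner ℝ (fderiv ℝ (w t) x (w t x)) (b x) + ν * inner ℝ ((Δ (w t)) x) (b x)
      - inner ℝ ((∇ (p t)) x) (b x)) (box ℓ) := j3.sub i4
  rw [e1, integral_sub j4 (hfl.const_mul χ), integral_sub j3 i4, integral_add j2 i3,
    integral_sub i1 i2,
    integral_const_mul, integral_const_mul,
    integral_inner_convective hℓ hw hb (h.periodic_w t ht.le) hpb (h.divFree t ht),
    integral_inner_gradient hℓ (h.contDiff_p t ht) hb (h.periodic_p t ht) hpb hdiv,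
    integral_inner_laplacian hℓ (h.contDiff_w t ht) hb (h.periodic_w t ht.le) hpb, ← e2,
    inner_L2_eq f.coeFn_toL2 hc, inner_L2_eq EventuallyEq.rfl hc]
  ring

theorem convection_eq (h : IsClassicalSolution ℓ ν χ δ N f u₀ u Du w p) {t : ℝ} (ht : 0 ≤ t)
    (φ : SmoothField ℓ) :
    convection (u t) φ = ∫ x in box ℓ, inner ℝ (fderiv ℝ φ x (w t x)) (w t x) := by
  refine integral_congr_ae ?_
  filter_upwards [h.u_eq t ht] with x hx
  rw [hx]

theorem u_zero (h : IsClassicalSolution ℓ ν χ δ N f u₀ u Du w p) : u 0 = u₀.toL2 :=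
  Lp.ext ((h.u_eq 0 le_rfl).trans (h.initial ▸ u₀.coeFn_toL2.symm))

/-- The equation is tested with w itself; convection and pressure drop out. -/
theorem hasDerivAt_norm_sq (h : IsClassicalSolution ℓ ν χ δ N f u₀ u Du w p) (hℓ : 0 < ℓ) {t : ℝ}
    (ht : 0 < t) : HasDerivAt (fun t => 1 / 2 * ‖u t‖ ^ 2) (inner ℝ f.toL2 (u t)
      - (ν * ‖Du t‖ ^ 2 + χ * inner ℝ (fluctuation ℓ δ N (u t)) (u t))) t := by
  obtain ⟨v, hv, hd, -⟩ := h.exists_deriv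
  have h1 := h.inner_deriv hℓ ht (hv t ht) (h.contDiff_one ht) (h.periodic_w t ht.le)
    (h.divFree t ht) (h.u_eq t ht.le) (h.Du_eq t ht)
  rw [integral_inner_convective_self hℓ (h.contDiff_one ht) (h.periodic_w t ht.le)
    (h.divFree t ht), sub_zero, real_inner_self_eq_norm_sq] at h1
  have h2 := (hd t ht).norm_sq.const_mul (1 / 2)
  rw [real_inner_comm, h1] at h2
  convert! h2 using 1
  ring

/-- The derivatives of w may be singular as t → 0. The work of the force minus the kinetic energy is
nevertheless continuous on [0, T] and has nonnegative derivative, the dissipation, inside; such a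
derivative is automatically integrable, and the fundamental theorem of calculus applies up to t = 0.
-/
theorem energy_identity (h : IsClassicalSolution ℓ ν χ δ N f u₀ u Du w p) (hℓ : 0 < ℓ)
    (hν : 0 < ν) (hχ : 0 < χ) (hδ : 0 < δ) {T : ℝ} (hT : 0 < T) :
    IntervalIntegrable
      (fun s => ν * ‖Du s‖ ^ 2 + χ * inner ℝ (fluctuation ℓ δ N (u s)) (u s)) volume 0 T ∧
    1 / 2 * ‖u T‖ ^ 2 + ∫ s in (0 : ℝ)..T,
      (ν * ‖Du s‖ ^ 2 + χ * inner ℝ (fluctuation ℓ δ N (u s)) (u s))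
        = 1 / 2 * ‖u₀.toL2‖ ^ 2 + ∫ s in (0 : ℝ)..T, inner ℝ f.toL2 (u s) := by
  have hu : ContinuousOn u (Set.Icc 0 T) := h.continuousOn_u.mono Set.Icc_subset_Ici_self
  have hfu : ContinuousOn (fun s => inner ℝ f.toL2 (u s)) (Set.Ici 0) :=
    continuousOn_const.inner h.continuousOn_u
  have hfi : IntervalIntegrable (fun s => inner ℝ f.toL2 (u s)) volume 0 T :=
    (hfu.mono (by rw [Set.uIcc_of_le hT.le]; exact Set.Icc_subset_Ici_self)).intervalIntegrable
  have hprim : ContinuousOn (fun t => ∫ s in (0 : ℝ)..t, inner ℝ f.toL2 (u s)) (Set.Icc 0 T) := by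
    have := intervalIntegral.continuousOn_primitive_interval
      ((intervalIntegrable_iff' (by simp)).1 hfi)
    rwa [Set.uIcc_of_le hT.le] at this
  set y : ℝ → ℝ := fun t => (∫ s in (0 : ℝ)..t, inner ℝ f.toL2 (u s)) - 1 / 2 * ‖u t‖ ^ 2 with hy
  have hyc : ContinuousOn y (Set.Icc 0 T) :=
    hprim.sub (continuousOn_const.mul (hu.norm.pow 2))
  have hyd : ∀ t ∈ Set.Ioo 0 T, HasDerivAt y
      (ν * ‖Du t‖ ^ 2 + χ * inner ℝ (fluctuation ℓ δ N (u t)) (u t)) t := by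
    intro t ht
    have h1 : HasDerivAt (fun t => ∫ s in (0 : ℝ)..t, inner ℝ f.toL2 (u s))
        (inner ℝ f.toL2 (u t)) t := by
      refine intervalIntegral.integral_hasDerivAt_right ?_ ?_ ?_
      · exact hfi.mono_set (by
          rw [Set.uIcc_of_le hT.le, Set.uIcc_of_le ht.1.le]
          exact Set.Icc_subset_Icc_right ht.2.le)
      · exact (hfu.mono Set.Ioi_subset_Ici_self).stronglyMeasurableAtFilter isOpen_Ioi t ht.1
      · exact hfu.continuousAt (Ici_mem_nhds ht.1)
    convert! h1.sub (h.hasDerivAt_norm_sq hℓ ht.1) using 1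
    ring
  have hint : IntervalIntegrable
      (fun s => ν * ‖Du s‖ ^ 2 + χ * inner ℝ (fluctuation ℓ δ N (u s)) (u s)) volume 0 T := by
    refine intervalIntegral.intervalIntegrable_deriv_of_nonneg (g := y) ?_ ?_ ?_
    · rwa [Set.uIcc_of_le hT.le]
    · rwa [min_eq_left hT.le, max_eq_right hT.le]
    · intro t _
      have := inner_fluctuation_self_nonneg (N := N) hδ (u t)
      positivity
  refine ⟨hint, ?_⟩
  rw [intervalIntegral.integral_eq_sub_of_hasDerivAt_of_le hT.le hyc hyd hint]
  simp only [hy, intervalIntegral.integral_same, h.u_zero]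
  ring

theorem memLp_top (h : IsClassicalSolution ℓ ν χ δ N f u₀ u Du w p) (T : ℝ) :
    MemLp u ⊤ (volume.restrict (Set.Ioc 0 T)) := by
  have hu : ContinuousOn u (Set.Icc 0 T) := h.continuousOn_u.mono Set.Icc_subset_Ici_self
  obtain ⟨C, hC⟩ := isCompact_Icc.exists_bound_of_continuousOn hu
  refine MemLp.of_bound ((hu.mono Set.Ioc_subset_Icc_self).aestronglyMeasurable
    measurableSet_Ioc) C ?_
  exact ae_restrict_of_forall_mem measurableSet_Ioc fun t ht => hC t (Set.Ioc_subset_Icc_self ht)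

theorem memLp_two_Du (h : IsClassicalSolution ℓ ν χ δ N f u₀ u Du w p) (hℓ : 0 < ℓ)
    (hν : 0 < ν) (hχ : 0 < χ) (hδ : 0 < δ) {T : ℝ} (hT : 0 < T) :
    MemLp Du 2 (volume.restrict (Set.Ioc 0 T)) := by
  have hm : AEStronglyMeasurable Du (volume.restrict (Set.Ioc 0 T)) :=
    (h.continuousOn_Du.mono Set.Ioc_subset_Ioi_self).aestronglyMeasurable measurableSet_Ioc
  rw [memLp_two_iff_integrable_sq_norm hm]
  have hi := (intervalIntegrable_iff_integrableOn_Ioc_of_le hT.le).1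
    (h.energy_identity hℓ hν hχ hδ hT).1
  refine (hi.const_mul ν⁻¹).mono' (hm.norm.pow 2) (Eventually.of_forall fun t => ?_)
  have := inner_fluctuation_self_nonneg (N := N) hδ (u t)
  rw [Real.norm_of_nonneg (sq_nonneg _), mul_add, inv_mul_cancel_left₀ hν.ne']
  exact le_add_of_nonneg_right (by positivity)

theorem weak_identity (h : IsClassicalSolution ℓ ν χ δ N f u₀ u Du w p) (hℓ : 0 < ℓ)
    (hν : 0 < ν) (hχ : 0 < χ) (hδ : 0 < δ) {φ : SmoothField ℓ} (hφ : φ.IsSolenoidal) {T : ℝ}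
    (hT : 0 < T) :
    inner ℝ (u T) φ.toL2 + ∫ s in (0 : ℝ)..T,
        (ν * inner ℝ (Du s) φ.grad - convection (u s) φ
          + χ * inner ℝ (fluctuation ℓ δ N (u s)) φ.toL2)
      = inner ℝ u₀.toL2 φ.toL2 + ∫ _s in (0 : ℝ)..T, inner ℝ f.toL2 φ.toL2 := by
  obtain ⟨v, hv, hd, hvc⟩ := h.exists_deriv
  have heq : ∀ t > 0, inner ℝ (v t) φ.toL2 = inner ℝ f.toL2 φ.toL2
      - (ν * inner ℝ (Du t) φ.grad - convection (u t) φ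
        + χ * inner ℝ (fluctuation ℓ δ N (u t)) φ.toL2) := by
    intro t ht
    rw [h.convection_eq ht.le]
    exact h.inner_deriv hℓ ht (hv t ht) φ.contDiff_one φ.periodic hφ.1 φ.coeFn_toL2
      fun i => (φ.pderiv i).coeFn_toL2
  set q : ℝ → ℝ := fun s => ν * inner ℝ (Du s) φ.grad - convection (u s) φ
    + χ * inner ℝ (fluctuation ℓ δ N (u s)) φ.toL2 with hq
  -- Continuity is read off from the equation, which expresses q through the time derivative; the
  -- convective term need not be treated separately.
  have hqc : ContinuousOn q (Set.Ioi 0) := by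
    have : ContinuousOn (fun t => inner ℝ f.toL2 φ.toL2 - inner ℝ (v t) φ.toL2) (Set.Ioi 0) :=
      continuousOn_const.sub (hvc.inner continuousOn_const)
    refine this.congr fun t ht => ?_
    change q t = inner ℝ f.toL2 φ.toL2 - inner ℝ (v t) φ.toL2
    rw [heq t ht, sub_sub_cancel]
  -- Near t = 0 the viscous term is dominated through the square integrability of `Du` that the
  -- energy identity provides.
  have hqi : IntervalIntegrable q volume 0 T := by
    rw [intervalIntegrable_iff_integrableOn_Ioc_of_le hT.le]
    have i1 : IntegrableOn (fun t => ν * (1 / 2 * ‖Du t‖ ^ 2 + 1 / (2 * 1) * ‖φ.grad‖ ^ 2))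
        (Set.Ioc 0 T) :=
      ((((h.memLp_two_Du hℓ hν hχ hδ hT).integrable_norm_pow two_ne_zero).const_mul _).add
        (integrable_const _)).const_mul ν
    have i2 : IntegrableOn (fun t => gradSup φ * ‖u t‖ ^ 2) (Set.Ioc 0 T) :=
      (((h.memLp_top T).mono_exponent le_top : MemLp u 2 _).integrable_norm_pow
        two_ne_zero).const_mul _
    have i3 : IntegrableOn (fun t => |χ * inner ℝ (fluctuation ℓ δ N (u t)) φ.toL2|)
        (Set.Ioc 0 T) :=
      (((((fluctuation ℓ δ N).comp_memLp' (h.memLp_top T)).integrable le_top).inner_const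
        φ.toL2).const_mul χ).norm
    refine ((i1.add i2).add i3).mono' ((hqc.mono Set.Ioc_subset_Ioi_self).aestronglyMeasurable
      measurableSet_Ioc) (Eventually.of_forall fun t => ?_)
    have e1 := mul_le_mul_of_nonneg_left (young_inner (Du t) φ.grad one_pos) hν.le
    have e2 := abs_convection_le (u t) φ
    refine (abs_add_le _ _).trans (add_le_add_left ((abs_sub _ _).trans ?_) _)
    rw [abs_mul, abs_of_pos hν]
    exact add_le_add e1 e2
  have hyc : ContinuousOn (fun t => inner ℝ (u t) φ.toL2) (Set.Icc 0 T) :=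
    (h.continuousOn_u.mono Set.Icc_subset_Ici_self).inner continuousOn_const
  have hyd : ∀ t ∈ Set.Ioo 0 T, HasDerivAt (fun t => inner ℝ (u t) φ.toL2)
      (inner ℝ f.toL2 φ.toL2 - q t) t := by
    intro t ht
    have := (hd t ht.1).inner ℝ (hasDerivAt_const t φ.toL2)
    rwa [inner_zero_right, zero_add, heq t ht.1] at this
  have h3 := intervalIntegral.integral_eq_sub_of_hasDerivAt_of_le hT.le hyc hyd
    (intervalIntegrable_const.sub hqi)
  rw [intervalIntegral.integral_sub intervalIntegrable_const hqi, h.u_zero] at h3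
  linarith

theorem isLerayHopfSolution (h : IsClassicalSolution ℓ ν χ δ N f u₀ u Du w p) (hℓ : 0 < ℓ)
    (hν : 0 < ν) (hχ : 0 < χ) (hδ : 0 < δ) : IsLerayHopfSolution ℓ ν χ δ N f u₀ u Du where
  memLp_u T _ := h.memLp_top T
  memLp_Du _ hT := h.memLp_two_Du hℓ hν hχ hδ hT
  weakGradient := ae_restrict_of_forall_mem measurableSet_Ioi fun t ht =>
    isWeakGradient_of_contDiff hℓ (h.contDiff_one ht) (h.periodic_w t (le_of_lt ht))
      (h.u_eq t (le_of_lt ht)) (h.Du_eq t ht)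
  divFree := ae_restrict_of_forall_mem measurableSet_Ioi fun t ht => by
    filter_upwards [ae_all_iff.2 (h.Du_eq t ht)] with x hx
    simp only [hx]
    exact h.divFree t ht x
  meanZero := ae_restrict_of_forall_mem measurableSet_Ioi fun t ht =>
    meanZero_congr (h.u_eq t (le_of_lt ht)) (h.meanZero t ht)
  weakForm _ hφ := ae_restrict_of_forall_mem measurableSet_Ioi fun _ ht =>
    h.weak_identity hℓ hν hχ hδ hφ ht
  energy := ae_restrict_of_forall_mem measurableSet_Ioi fun _ ht =>
    (h.energy_identity hℓ hν hχ hδ ht).2.le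

end IsClassicalSolution

end TRM

end

theorem mainTheorem1 (ℓ ν χ δ : ℝ) (hℓ : 0 < ℓ) (hν : 0 < ν) (hχ : 0 < χ) (hδ : 0 < δ) (N : ℕ)
    (f u₀ : TRM.SmoothField ℓ) (hf : f.IsSolenoidal) (hu₀ : u₀.IsSolenoidal)
    (hf0 : ∃ x, f x ≠ 0)
    (u : ℝ → TRM.L2 ℓ) (Du : ℝ → TRM.L2Grad ℓ) (hu : TRM.IsSolution ℓ ν χ δ N f u₀ u Du)
    (U L Re RN : ℝ) (hU : U = TRM.velocityScale u) (hL : L = TRM.lengthScale δ N f)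
    (hRe : Re = TRM.reynolds U L ν) (hRN : RN = TRM.relaxationNumber U L χ δ N) :
    TRM.HasTimeAvg (TRM.meanSquare u) ∧
    TRM.HasTimeAvg (TRM.dissipation ℓ ν χ δ N u Du) ∧
    0 < U ∧ 0 < L ∧
    TRM.timeAvg (TRM.dissipation ℓ ν χ δ N u Du) ≤ (2 + 1 / Re + 1 / RN) * (U ^ 3 / L) := by
  have h : TRM.IsLerayHopfSolution ℓ ν χ δ N f u₀ u Du := by
    rcases hu with h | ⟨w, p, h⟩
    · exact h
    · exact h.isLerayHopfSolution hℓ hν hχ hδ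
  subst hRe hRN hU hL
  obtain ⟨ha, hd, hUpos, hle⟩ := h.dissipation_le hℓ hν hχ hδ hf hf0
  exact ⟨ha, hd, hUpos, TRM.lengthScale_pos hℓ hδ hf hf0, hle⟩
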